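/- **Setting.** Let $\tau:\mathbb N^*\to\mathbb N$ be non-decreasing with $\tau(1)=0$, $\tau(n)\le n$ and $\tau(n)/n\to0$. Put $u(1)=1$, $t(1)=0$ and, for $n\ge2$, $u(n)=\max\{m\ge1: 2m+\tau(m)\le n\}$, $t(n)=n-2u(n)$. Let $N(n)\ge 1$ be a non-decreasing sequence of integers tending to $\infty$, and let $X_{n,i}$, $1\le i\le N(n)$, be a triangular array of real random variables on a probability space $(\Omega,\mathcal F,P)$. Let $u^r$ be the $r$-th iterate of $u$ ($u^0(m)=m$), and write $m_r=u^r(N(n))$ for $r\ge0$ and $t_r=t(u^{r-1}(N(n)))$ for $r\ge1$. For every $r$ let $\sigma_r(n)$ be a sequence of reals with $\sigma_r(n)>0$ whenever $m_r>1$. For $m_r>1$ set $$S_{r,n}=\frac1{\sigma_r(n)}\sum_{i=1}^{m_r}X_{n,i},\qquad \xi_{r,n}=\frac1{\sigma_r(n)}\sum_{i=m_r+1}^{m_r+t_r}X_{n,i},\qquad S'_{r,n}=\frac1{\sigma_r(n)}\sum_{i=m_r+t_r+1}^{m_r+t_r+m_r}X_{n,i},$$ the last two for $r\ge1$. (For given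 $r$, $m_r>1$ holds for all large $n$; the other $n$ play no role.) For every $k\in\mathbb N$ let $\{J_{k,j}\}_{j\in\mathbb N_k}$, $\mathbb N_k\subset\mathbb N$, be a partition of $\mathbb R$ into intervals of length $4^{-k}$, finitely many of which cover any given bounded interval; the partitions are nested (each $J_{k+1,j}$ lies in some $J_{k,i}$). Let $\mathfrak J_k\subset\mathbb N_k$ be the smallest set of indices such that $[-2^k,2^k]\subset\bigcup_{j\in\mathfrak J_k}J_{k,j}$, and let $\mathfrak C_k$ be the $\sigma$-algebra on $\mathbb R$ generated by $\{J_{k,j}\}_{j\in\mathfrak J_k}$. Define $$\varepsilon^I_{k,h}(n)=\sup_{n'\ge n,\ 1\le r\le h,\ B,B'\in\mathfrak C_k}\bigl|P\{S_{r,n'}\in B,\ S'_{r,n'}\in B'\}-P\{S_{r,n'}\in B\}P\{S'_{r,n'}\in B'\}\bigr|,$$ $$\varepsilon^S_{k,h}(n)=\sup_{n'\ge n,\ 1\le r\le h,\ B\in\mathfrak C_k}\bigl|P\{S_{r,n'}\in B\}-P\{S'_{r,n'}\in B\}\bigr|$$ (suprema over those pairs $(n',r)$ for which $S_{r,n'}$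 is defined). **Assumptions.** 1. $E\{X_{n,i}\}=0$ and $E\{X_{n,i}^2\}<\infty$ for all $n$ and $1\le i\le N(n)$. 2. $\sigma_r(n)^2=E\{(X_{n,1}+\dots+X_{n,m_r})^2\}$ whenever $m_r>1$. 3. For all $k,h\in\mathbb N$, $\varepsilon^I_{k,h}(n)\to0$ and $\varepsilon^S_{k,h}(n)\to0$ as $n\to\infty$. 4. For every $h$ there is a non-increasing sequence $\varepsilon_h(n)\to0$ with $P\{|\xi_{r,n}|>\varepsilon_h(n)\}<\varepsilon_h(n)$ for $r=1,\dots,h$ (and all $n$ for which $\xi_{r,n}$ is defined). **Statement.** Under these assumptions, $S_{r,n}\xrightarrow{d}N(0,1)$ as $n\to\infty$ for all $r\in\mathbb N$ (including $r=0$) if and only if both of the following hold: * for all $r\ge1$, $\ \sigma_{r-1}(n)/\sigma_r(n)\to\sqrt2$ as $n\to\infty$; * there exist an increasing sequence $(N_k)$ of natural numbers and a real sequence $\varepsilon_k\to0$ such that, for all $k$, all $n>N_k$ and all $r\le k$, $$E\bigl\{S_{r,n}^2\,\mathbf 1_{\{|S_{r,n}|>2^{k/4}\}}\bigr\}\le\varepsilon_k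 .$$ -/

import Mathlib

open MeasureTheory ProbabilityTheory Filter Topology Set

noncomputable section

namespace BlockCLT

/-! ### Splitting `n` into two blocks of length `u(n)` separated by a gap of length `t(n)` -/

/-- The admissible gap sequences `τ : ℕ* → ℕ` (the value `τ 0` plays no role). -/
structure IsGapSequence (τ : ℕ → ℕ) : Prop where
  monotone : Monotone τ
  map_one : τ 1 = 0
  le_self : ∀ n, 1 ≤ n → τ n ≤ n
  tendsto_div : Tendsto (fun n : ℕ => (τ n : ℝ) / n) atTop (𝓝 0)

/-- `u(1) = 1` and `u(n) = max {m ≥ 1 | 2 m + τ(m) ≤ n}` for `n ≥ 2`. -/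
def blockLen (τ : ℕ → ℕ) (n : ℕ) : ℕ :=
  if n ≤ 1 then 1 else sSup {m : ℕ | 1 ≤ m ∧ 2 * m + τ m ≤ n}

/-- `t(1) = 0` and `t(n) = n - 2 u(n)` for `n ≥ 2`. -/
def gapLen (τ : ℕ → ℕ) (n : ℕ) : ℕ :=
  if n ≤ 1 then 0 else n - 2 * blockLen τ n

/-- For `n ≥ 2` the number `u(n)` is indeed the maximum of the set that defines it. -/
theorem isGreatest_blockLen {τ : ℕ → ℕ} (hτ : IsGapSequence τ) {n : ℕ} (hn : 2 ≤ n) :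
    IsGreatest {m : ℕ | 1 ≤ m ∧ 2 * m + τ m ≤ n} (blockLen τ n) := by
  have hne : ({m : ℕ | 1 ≤ m ∧ 2 * m + τ m ≤ n}).Nonempty :=
    ⟨1, le_refl 1, by rw [hτ.map_one]; omega⟩
  have hbd : BddAbove {m : ℕ | 1 ≤ m ∧ 2 * m + τ m ≤ n} :=
    ⟨n, fun m hm => by have := hm.2; omega⟩
  have h : blockLen τ n = sSup {m : ℕ | 1 ≤ m ∧ 2 * m + τ m ≤ n} := by
    unfold blockLen; rw [if_neg (by omega)]
  rw [h]
  exact ⟨Nat.sSup_mem hne hbd, fun m hm => le_csSup hbd hm⟩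

/-- For `n ≥ 2` the two blocks and the gap fill `n` exactly. -/
theorem block_add_gap_add_block {τ : ℕ → ℕ} (hτ : IsGapSequence τ) {n : ℕ} (hn : 2 ≤ n) :
    blockLen τ n + gapLen τ n + blockLen τ n = n := by
  have h := (isGreatest_blockLen hτ hn).1.2
  unfold gapLen
  rw [if_neg (by omega)]
  omega

/-- `u^r(N(n))`, the `r`-th iterate of `u` at `N(n)`; `u^0(N(n)) = N(n)`. -/
def iterBlock (τ N : ℕ → ℕ) (r n : ℕ) : ℕ := (blockLen τ)^[r] (N n)

/-- `t_r(N(n)) = t(u^{r-1}(N(n)))` (used for `r ≥ 1` only). -/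
def iterGap (τ N : ℕ → ℕ) (r n : ℕ) : ℕ := gapLen τ (iterBlock τ N (r - 1) n)

/-! ### The normalized partial sums of row `n` at level `r` -/

variable {Ω : Type*}

/-- `S_{r,n}`, the normalized sum over the first block. -/
def blockSum (τ N : ℕ → ℕ) (X : ℕ → ℕ → Ω → ℝ) (σ : ℕ → ℕ → ℝ) (r n : ℕ) (ω : Ω) : ℝ :=
  (σ r n)⁻¹ * ∑ i ∈ Finset.Icc 1 (iterBlock τ N r n), X n i ω

/-- `ξ_{r,n}`, the normalized sum over the gap. -/
def gapSum (τ N : ℕ → ℕ) (X : ℕ → ℕ → Ω → ℝ) (σ : ℕ → ℕ → ℝ) (r n : ℕ) (ω : Ω) : ℝ :=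
  (σ r n)⁻¹ * ∑ i ∈ Finset.Icc (iterBlock τ N r n + 1) (iterBlock τ N r n + iterGap τ N r n),
    X n i ω

/-- `S'_{r,n}`, the normalized sum over the second block. -/
def blockSum' (τ N : ℕ → ℕ) (X : ℕ → ℕ → Ω → ℝ) (σ : ℕ → ℕ → ℝ) (r n : ℕ) (ω : Ω) : ℝ :=
  (σ r n)⁻¹ * ∑ i ∈ Finset.Icc (iterBlock τ N r n + iterGap τ N r n + 1)
    (iterBlock τ N r n + iterGap τ N r n + iterBlock τ N r n), X n i ω

/-! ### Nested partitions of the line into intervals of length `4^{-k}` -/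

/-- A sequence of nested partitions of `ℝ`: the `k`-th one consists of the intervals `J k j`,
`j ∈ idx k`, all of length `4^{-k}`, and finitely many of them cover any bounded interval. -/
structure NestedPartitions where
  idx : ℕ → Set ℕ
  J : ℕ → ℕ → Set ℝ
  ordConnected : ∀ k, ∀ j ∈ idx k, (J k j).OrdConnected
  pairwiseDisjoint : ∀ k, (idx k).PairwiseDisjoint (J k)
  iUnion_eq : ∀ k, ⋃ j ∈ idx k, J k j = univ
  nested : ∀ k, ∀ j ∈ idx (k + 1), ∃ i ∈ idx k, J (k + 1) j ⊆ J k i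
  length_eq : ∀ k, ∀ j ∈ idx k, volume (J k j) = ENNReal.ofReal ((4 : ℝ)⁻¹ ^ k)
  finite_cover : ∀ k, ∀ a b : ℝ, ∃ F : Finset ℕ, (F : Set ℕ) ⊆ idx k ∧ Icc a b ⊆ ⋃ j ∈ F, J k j

/-- The smallest set of indices `j` for which the intervals `J k j` cover `[-2^k, 2^k]`
(see `isLeast_cells`). -/
def cells (𝒥 : NestedPartitions) (k : ℕ) : Set ℕ :=
  {j ∈ 𝒥.idx k | (𝒥.J k j ∩ Icc (-(2 : ℝ) ^ k) (2 ^ k)).Nonempty}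

theorem isLeast_cells (𝒥 : NestedPartitions) (k : ℕ) :
    IsLeast {A : Set ℕ | A ⊆ 𝒥.idx k ∧ Icc (-(2 : ℝ) ^ k) (2 ^ k) ⊆ ⋃ j ∈ A, 𝒥.J k j}
      (cells 𝒥 k) := by
  refine ⟨⟨fun j hj => hj.1, fun x hx => ?_⟩, fun A hA j hj => ?_⟩
  · have hx' : x ∈ ⋃ j ∈ 𝒥.idx k, 𝒥.J k j := by rw [𝒥.iUnion_eq k]; trivial
    simp only [mem_iUnion] at hx' ⊢
    obtain ⟨j, hj, hxj⟩ := hx'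
    exact ⟨j, ⟨hj, x, hxj, hx⟩, hxj⟩
  · obtain ⟨hj, x, hxj, hx⟩ := hj
    have hx' := hA.2 hx
    simp only [mem_iUnion] at hx'
    obtain ⟨i, hi, hxi⟩ := hx'
    have : i = j := by
      by_contra hne
      exact (Set.disjoint_left.1 (𝒥.pairwiseDisjoint k (hA.1 hi) hj hne)) hxi hxj
    exact this ▸ hi

/-- The σ-algebra on `ℝ` generated by the intervals `J k j`, `j ∈ cells k`. -/
abbrev cellAlgebra (𝒥 : NestedPartitions) (k : ℕ) : MeasurableSpace ℝ :=
  MeasurableSpace.generateFrom {B | ∃ j ∈ cells 𝒥 k, B = 𝒥.J k j}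

/-! ### The dependence and stationarity coefficients

The sums of level `r` in row `n` are considered when `u^r(N(n)) > 1`. -/

/-- `ε^I_{k,h}(n)`: the supremum over `n' ≥ n`, `1 ≤ r ≤ h` and `B, B'` in the `k`-th σ-algebra of
`|P(S_{r,n'} ∈ B, S'_{r,n'} ∈ B') - P(S_{r,n'} ∈ B) P(S'_{r,n'} ∈ B')|`. -/
def depCoeff [MeasurableSpace Ω] (P : Measure Ω) (τ N : ℕ → ℕ) (X : ℕ → ℕ → Ω → ℝ)
    (σ : ℕ → ℕ → ℝ) (𝒥 : NestedPartitions) (k h n : ℕ) : ℝ :=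
  sSup {x : ℝ | ∃ n' r : ℕ, n ≤ n' ∧ 1 ≤ r ∧ r ≤ h ∧ 1 < iterBlock τ N r n' ∧
    ∃ B B' : Set ℝ, MeasurableSet[cellAlgebra 𝒥 k] B ∧ MeasurableSet[cellAlgebra 𝒥 k] B' ∧
      x = |P.real {ω | blockSum τ N X σ r n' ω ∈ B ∧ blockSum' τ N X σ r n' ω ∈ B'} -
        P.real {ω | blockSum τ N X σ r n' ω ∈ B} * P.real {ω | blockSum' τ N X σ r n' ω ∈ B'}|}

/-- `ε^S_{k,h}(n)`: the supremum over `n' ≥ n`, `1 ≤ r ≤ h` and `B` in the `k`-th σ-algebra of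
`|P(S_{r,n'} ∈ B) - P(S'_{r,n'} ∈ B)|`. -/
def statCoeff [MeasurableSpace Ω] (P : Measure Ω) (τ N : ℕ → ℕ) (X : ℕ → ℕ → Ω → ℝ)
    (σ : ℕ → ℕ → ℝ) (𝒥 : NestedPartitions) (k h n : ℕ) : ℝ :=
  sSup {x : ℝ | ∃ n' r : ℕ, n ≤ n' ∧ 1 ≤ r ∧ r ≤ h ∧ 1 < iterBlock τ N r n' ∧
    ∃ B : Set ℝ, MeasurableSet[cellAlgebra 𝒥 k] B ∧
      x = |P.real {ω | blockSum τ N X σ r n' ω ∈ B} -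
        P.real {ω | blockSum' τ N X σ r n' ω ∈ B}|}

/-- The standing assumptions on the triangular array `X n i`, `1 ≤ i ≤ N n`, and the normalizing
constants `σ r n`. -/
structure ArrayAssumptions [MeasurableSpace Ω] (P : Measure Ω) (τ N : ℕ → ℕ)
    (X : ℕ → ℕ → Ω → ℝ) (σ : ℕ → ℕ → ℝ) (𝒥 : NestedPartitions) : Prop where
  gap : IsGapSequence τ
  one_le_N : ∀ n, 1 ≤ N n
  monotone_N : Monotone N
  tendsto_N : Tendsto N atTop atTop
  measurable : ∀ n i, 1 ≤ i → i ≤ N n → Measurable (X n i)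
  memLp_two : ∀ n i, 1 ≤ i → i ≤ N n → MemLp (X n i) 2 P
  mean_zero : ∀ n i, 1 ≤ i → i ≤ N n → ∫ ω, X n i ω ∂P = 0
  sigma_pos : ∀ r n, 1 < iterBlock τ N r n → 0 < σ r n
  sigma_sq : ∀ r n, 1 < iterBlock τ N r n →
    σ r n ^ 2 = ∫ ω, (∑ i ∈ Finset.Icc 1 (iterBlock τ N r n), X n i ω) ^ 2 ∂P
  tendsto_depCoeff : ∀ k h, Tendsto (depCoeff P τ N X σ 𝒥 k h) atTop (𝓝 0)
  tendsto_statCoeff : ∀ k h, Tendsto (statCoeff P τ N X σ 𝒥 k h) atTop (𝓝 0)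
  /-- For each `h` there is a non-increasing sequence `ε_h(n) → 0` such that
  `P(|ξ_{r,n}| > ε_h(n)) < ε_h(n)` for `r = 1, …, h`. -/
  gap_negligible : ∀ h : ℕ, ∃ δ : ℕ → ℝ, Antitone δ ∧ Tendsto δ atTop (𝓝 0) ∧
    ∀ n r : ℕ, 1 ≤ r → r ≤ h → 1 < iterBlock τ N r n →
      P.real {ω | δ n < |gapSum τ N X σ r n ω|} < δ n

end BlockCLT

end

open BlockCLT

/-! Let φ_r denote the characteristic function of S_r (the row index n is suppressed). The engine of
both directions is the exact identity (σ_r/σ_{r+1}) S_r = S_{r+1} + S'_{r+1} + ξ_{r+1}. The gap term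
vanishes in probability, and the two blocks are nearly independent and equidistributed when tested
on cells. Approximating the character by step functions on the cells therefore gives E exp(i t
(σ_r/σ_{r+1}) S_r) - φ_{r+1}(t)² → 0, whether or not the ratios converge
(`tendsto_expChar_ratio_mul`).

Sufficiency: if the ratios tend to √2, then φ_r(t) is asymptotic to φ_{r+1}(t/√2)², and h iterations
give φ_{r+h}(s)^(2^h) with s = t/2^(h/2). A second order expansion with truncation at 2^((r+h)/4)
replaces φ_{r+h}(s) by 1 - s²/2. The 2^h factors inflate its error to the order of t² ε_{r+h} + |t|³
2^((r+h)/4) 2^(-h/2), which vanishes as h grows because the truncation level grows more slowly than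
2^(h/2) (`tendsto_exp_of_halving`).

Necessity: S_r tends to N(0,1), while the identity forces (σ_r/σ_{r+1}) S_r to tend to N(0,2), so
convergence of types determines the ratio (`tendsto_scale_of_gaussian_limits`). Since E S_r² = 1 is
also the second moment of the limit, no mass of S_r² escapes to infinity, which is the truncated
moment bound (`setIntegral_sq_le_one_sub`). -/

namespace BlockCLT

/-! ### Characters and second order expansion of characteristic functions -/

/-- The character `x ↦ exp (i t x)`. -/
noncomputable def expChar (t x : ℝ) : ℂ := Complex.exp (t * x * Complex.I)

theorem norm_expChar (t x : ℝ) : ‖expChar t x‖ = 1 := by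
  have := Complex.norm_exp_ofReal_mul_I (t * x)
  simpa [expChar] using this

theorem continuous_expChar (t : ℝ) : Continuous (expChar t) := by
  unfold expChar; fun_prop

theorem expChar_add (t x y : ℝ) : expChar t (x + y) = expChar t x * expChar t y := by
  unfold expChar; rw [← Complex.exp_add]; push_cast; ring_nf

theorem expChar_mul (t c x : ℝ) : expChar t (c * x) = expChar (t * c) x := by
  unfold expChar; push_cast; ring_nf

theorem expChar_comm (t x : ℝ) : expChar t x = expChar x t := by
  unfold expChar; ring_nf

theorem norm_expChar_sub_one_le (t x : ℝ) : ‖expChar t x - 1‖ ≤ |t| * |x| := by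
  have := Real.norm_exp_I_mul_ofReal_sub_one_le (x := t * x)
  rw [Real.norm_eq_abs, abs_mul] at this
  convert this using 3
  unfold expChar; push_cast; ring_nf

theorem norm_expChar_sub_le (t x y : ℝ) : ‖expChar t x - expChar t y‖ ≤ |t| * |x - y| := by
  have h : expChar t x - expChar t y = expChar t y * (expChar t (x - y) - 1) := by
    rw [mul_sub, ← expChar_add]; simp
  rw [h, norm_mul, norm_expChar, one_mul]
  exact norm_expChar_sub_one_le _ _

theorem norm_expChar_sub_one_le_two (t x : ℝ) : ‖expChar t x - 1‖ ≤ 2 := by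
  refine (norm_sub_le _ _).trans ?_
  rw [norm_expChar]; norm_num

/-- The remainder of the second order Taylor expansion of the character. -/
theorem norm_expChar_sub_taylor_le (t x : ℝ) :
    ‖expChar t x - (1 + t * x * Complex.I - (t * x) ^ 2 / 2)‖ ≤
      4 * min ((t * x) ^ 2) (|t * x| ^ 3) := by
  set y := t * x with hy
  have he : expChar t x = Complex.exp (y * Complex.I) := by simp [expChar, hy]
  have hyx : ((t : ℂ) * x) = (y : ℂ) := by simp [hy]
  rw [he, hyx]
  have hn : ‖(y : ℂ) * Complex.I‖ = |y| := by simp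
  have hI : ((y : ℂ) * Complex.I) ^ 2 = -(y : ℂ) ^ 2 := by rw [mul_pow, Complex.I_sq]; ring
  rcases le_total |y| 1 with h | h
  · have hb := Complex.exp_bound (x := (y : ℂ) * Complex.I) (by rw [hn]; exact h)
      (n := 3) (by norm_num)
    simp only [Finset.sum_range_succ, Finset.range_zero, Finset.sum_empty, hn] at hb
    norm_num [Nat.factorial, hI] at hb
    have h3 : |y| ^ 3 ≤ y ^ 2 := by
      rw [← sq_abs y]; exact pow_le_pow_of_le_one (abs_nonneg y) h (by norm_num)
    rw [min_eq_right h3]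
    have : (Complex.exp (y * Complex.I) - (1 + y * Complex.I - (y : ℂ) ^ 2 / 2)) =
      Complex.exp (y * Complex.I) - (1 + y * Complex.I + -(y : ℂ) ^ 2 / 2) := by ring
    rw [this]
    have h0 : 0 ≤ |y| ^ 3 := by positivity
    refine hb.trans ?_
    linarith
  · have h2 : y ^ 2 ≤ |y| ^ 3 := by
      rw [← sq_abs y]; exact pow_le_pow_right₀ h (by norm_num)
    rw [min_eq_left h2]
    have hsq : |y| ≤ y ^ 2 := by rw [← sq_abs y]; nlinarith
    have h1 : 1 ≤ y ^ 2 := h.trans hsq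
    have a1 : ‖Complex.exp (y * Complex.I)‖ = 1 := Complex.norm_exp_ofReal_mul_I y
    have a2 : ‖(y : ℂ) ^ 2 / 2‖ = y ^ 2 / 2 := by simp
    calc _ ≤ ‖Complex.exp (y * Complex.I)‖ + (‖(1 : ℂ)‖ + ‖(y : ℂ) * Complex.I‖ + ‖(y : ℂ) ^ 2 / 2‖) :=
          (norm_sub_le _ _).trans (add_le_add le_rfl ((norm_sub_le _ _).trans
            (add_le_add (norm_add_le _ _) le_rfl)))
      _ ≤ 4 * y ^ 2 := by rw [a1, a2, hn, norm_one]; linarith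

variable {Ω : Type*} [MeasurableSpace Ω] {P : Measure Ω}

theorem charFun_map_eq {A : Ω → ℝ} (hA : AEMeasurable A P) (t : ℝ) :
    charFun (P.map A) t = ∫ ω, expChar t (A ω) ∂P := by
  rw [charFun_apply_real]
  exact integral_map hA (continuous_expChar t).measurable.aestronglyMeasurable

variable [IsProbabilityMeasure P]

theorem integrable_expChar {A : Ω → ℝ} (hA : AEMeasurable A P) (t : ℝ) :
    Integrable (fun ω => expChar t (A ω)) P := by
  refine Integrable.of_bound (C := 1)
    ((continuous_expChar t).measurable.comp_aemeasurable hA).aestronglyMeasurable ?_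
  exact Eventually.of_forall fun ω => (norm_expChar _ _).le

theorem norm_integral_expChar_le (A : Ω → ℝ) (t : ℝ) : ‖∫ ω, expChar t (A ω) ∂P‖ ≤ 1 := by
  have := norm_integral_le_of_norm_le_const (μ := P) (f := fun ω => expChar t (A ω)) (C := 1)
    (Eventually.of_forall fun ω => (norm_expChar _ _).le)
  simpa using this

/-- Lévy's continuity theorem for a centred Gaussian limit. -/
theorem tendstoInDistribution_gaussian_iff {A : ℕ → Ω → ℝ} (hA : ∀ n, AEMeasurable (A n) P)
    (v : NNReal) :
    TendstoInDistribution A atTop (id : ℝ → ℝ) (fun _ => P) (gaussianReal 0 v) ↔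
      ∀ t : ℝ, Tendsto (fun n => ∫ ω, expChar t (A n ω) ∂P) atTop
        (𝓝 (Complex.exp (-(v * t ^ 2 / 2)))) := by
  have key : Tendsto (β := ProbabilityMeasure ℝ)
      (fun n ↦ ⟨P.map (A n), Measure.isProbabilityMeasure_map (hA n)⟩) atTop
      (𝓝 ⟨(gaussianReal 0 v).map id, Measure.isProbabilityMeasure_map aemeasurable_id⟩) ↔
      ∀ t : ℝ, Tendsto (fun n => ∫ ω, expChar t (A n ω) ∂P) atTop
        (𝓝 (Complex.exp (-(v * t ^ 2 / 2)))) := by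
    refine ProbabilityMeasure.tendsto_iff_tendsto_charFun.trans (forall_congr' fun t => ?_)
    have h1 : charFun ((gaussianReal 0 v).map id) t = Complex.exp (-(v * t ^ 2 / 2)) := by
      rw [Measure.map_id, charFun_gaussianReal]; simp
    simp only [ProbabilityMeasure.coe_mk, h1, charFun_map_eq (hA _)]
  exact ⟨fun h => key.1 h.tendsto, fun h => ⟨hA, aemeasurable_id, key.2 h⟩⟩

theorem norm_integral_expChar_sub_le {A : Ω → ℝ} (hA : Integrable A P) (s t : ℝ) :
    ‖∫ ω, expChar s (A ω) ∂P - ∫ ω, expChar t (A ω) ∂P‖ ≤ |s - t| * ∫ ω, |A ω| ∂P := by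
  rw [← integral_sub (integrable_expChar hA.aemeasurable s) (integrable_expChar hA.aemeasurable t),
    ← integral_const_mul]
  refine norm_integral_le_of_norm_le (hA.abs.const_mul _) (Eventually.of_forall fun ω => ?_)
  rw [expChar_comm s, expChar_comm t, mul_comm]
  exact norm_expChar_sub_le _ _ _

theorem integral_abs_le_one {A : Ω → ℝ} (hA : MemLp A 2 P) (h1 : ∫ ω, A ω ^ 2 ∂P ≤ 1) :
    ∫ ω, |A ω| ∂P ≤ 1 := by
  have hi : Integrable (fun ω => A ω ^ 2) P := hA.integrable_sq
  calc ∫ ω, |A ω| ∂P ≤ ∫ ω, (1 / 2 + (1 / 2) * A ω ^ 2) ∂P := by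
        refine integral_mono (hA.integrable one_le_two).abs
          ((integrable_const _).add (hi.const_mul _)) fun ω => ?_
        have := sq_nonneg (|A ω| - 1)
        have h2 := sq_abs (A ω)
        simp only
        nlinarith
    _ ≤ 1 := by
        rw [integral_add (integrable_const _) (hi.const_mul _), integral_const_mul]
        simp
        linarith

/-- Second order expansion of the characteristic function of a standardized variable. -/
theorem norm_integral_expChar_sub_taylor_le {A : Ω → ℝ} (hm : Measurable A) (hA : MemLp A 2 P)
    (h0 : ∫ ω, A ω ∂P = 0)
    (h1 : ∫ ω, A ω ^ 2 ∂P = 1) {K ε : ℝ} (hK : 0 ≤ K)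
    (hε : ∫ ω in {ω | K < |A ω|}, A ω ^ 2 ∂P ≤ ε) (s : ℝ) :
    ‖∫ ω, expChar s (A ω) ∂P - (1 - (s : ℂ) ^ 2 / 2)‖ ≤ 4 * (s ^ 2 * ε + |s| ^ 3 * K) := by
  have hi : Integrable (fun ω => A ω ^ 2) P := hA.integrable_sq
  have hi1 : Integrable A P := hA.integrable one_le_two
  have hms : MeasurableSet {ω | K < |A ω|} := measurableSet_lt measurable_const hm.abs
  have e1 : Integrable (fun ω => (s * A ω * Complex.I : ℂ)) P :=
    (hi1.ofReal.const_mul _).mul_const _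
  have e2 : Integrable (fun ω => ((s * A ω) ^ 2 / 2 : ℂ)) P := by
    have := (hi.ofReal (𝕜 := ℂ)).const_mul ((s : ℂ) ^ 2 / 2)
    refine this.congr (Eventually.of_forall fun ω => ?_)
    simp; ring
  have e3 : Integrable (fun ω => (1 + s * A ω * Complex.I : ℂ)) P := (integrable_const _).add e1
  have hTi : Integrable (fun ω => (1 + s * A ω * Complex.I - (s * A ω) ^ 2 / 2 : ℂ)) P := e3.sub e2
  have hT : ∫ ω, (1 + s * A ω * Complex.I - (s * A ω) ^ 2 / 2 : ℂ) ∂P = 1 - (s : ℂ) ^ 2 / 2 := by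
    rw [integral_sub e3 e2, integral_add (integrable_const _) e1]
    have f1 : ∫ ω, (s * A ω * Complex.I : ℂ) ∂P = 0 := by
      rw [integral_mul_const, integral_const_mul, integral_complex_ofReal, h0]; simp
    have f2 : ∫ ω, ((s * A ω) ^ 2 / 2 : ℂ) ∂P = (s : ℂ) ^ 2 / 2 := by
      have : ∀ ω, ((s * A ω) ^ 2 / 2 : ℂ) = (s : ℂ) ^ 2 / 2 * ((A ω ^ 2 : ℝ) : ℂ) := by
        intro ω; push_cast; ring
      simp_rw [this]
      rw [integral_const_mul, integral_complex_ofReal, h1]; simp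
    rw [f1, f2]; simp
  rw [← hT, ← integral_sub (integrable_expChar hm.aemeasurable s) hTi]
  have hbi : Integrable (fun ω => 4 * (s ^ 2 * ({ω | K < |A ω|}.indicator (fun ω => A ω ^ 2) ω)
      + |s| ^ 3 * K * A ω ^ 2)) P :=
    (((hi.indicator hms).const_mul _).add (hi.const_mul _)).const_mul _
  refine (norm_integral_le_of_norm_le hbi (Eventually.of_forall fun ω => ?_)).trans ?_
  · refine (norm_expChar_sub_taylor_le s (A ω)).trans ?_
    refine mul_le_mul_of_nonneg_left ?_ (by norm_num)
    -- The quadratic remainder is used on the tail. Elsewhere the cubic one is, where |A|³ ≤ K A².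
    by_cases h : K < |A ω|
    · rw [indicator_of_mem (by exact h)]
      refine (min_le_left _ _).trans ?_
      rw [mul_pow]
      have : 0 ≤ |s| ^ 3 * K * A ω ^ 2 := by positivity
      linarith
    · rw [indicator_of_notMem (by exact h)]
      refine (min_le_right _ _).trans ?_
      rw [abs_mul, mul_pow, mul_zero, zero_add, mul_assoc]
      refine mul_le_mul_of_nonneg_left ?_ (by positivity)
      rw [pow_succ', sq_abs]
      exact mul_le_mul_of_nonneg_right (not_lt.1 h) (sq_nonneg _)
  · rw [integral_const_mul, integral_add ((hi.indicator hms).const_mul _) (hi.const_mul _),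
      integral_const_mul, integral_const_mul, h1, integral_indicator hms, mul_one]
    gcongr

theorem norm_pow_sub_pow_le {z w : ℂ} (hz : ‖z‖ ≤ 1) (hw : ‖w‖ ≤ 1) (n : ℕ) :
    ‖z ^ n - w ^ n‖ ≤ n * ‖z - w‖ := by
  induction n with
  | zero => simp
  | succ n ih =>
    have h : z ^ (n + 1) - w ^ (n + 1) = z ^ n * (z - w) + (z ^ n - w ^ n) * w := by ring
    have h1 : ‖z ^ n‖ ≤ 1 := by rw [norm_pow]; exact pow_le_one₀ (norm_nonneg _) hz
    rw [h]
    calc _ ≤ ‖z ^ n‖ * ‖z - w‖ + ‖z ^ n - w ^ n‖ * ‖w‖ := by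
          refine (norm_add_le _ _).trans ?_; rw [norm_mul, norm_mul]
      _ ≤ 1 * ‖z - w‖ + (n * ‖z - w‖) * 1 := by gcongr
      _ = _ := by push_cast; ring

/-! ### Iterated halving and the Gaussian limit -/

section Iteration

variable {f : ℕ → ℕ → ℝ → ℂ}

/-- Iterating an asymptotic halving relation between consecutive levels. -/
theorem tendsto_sub_iterate (hf : ∀ r n t, ‖f r n t‖ ≤ 1)
    (hrec : ∀ r t, Tendsto (fun n => f r n t - f (r + 1) n (t / √2) ^ 2) atTop (𝓝 0))
    (r h : ℕ) (t : ℝ) :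
    Tendsto (fun n => f r n t - f (r + h) n (t / √2 ^ h) ^ 2 ^ h) atTop (𝓝 0) := by
  induction h with
  | zero => simp
  | succ h ih =>
    have hlim : Tendsto (fun n => f (r + h) n (t / √2 ^ h) ^ 2 ^ h -
        (f (r + h + 1) n (t / √2 ^ h / √2) ^ 2) ^ 2 ^ h) atTop (𝓝 0) := by
      have h0 := ((hrec (r + h) (t / √2 ^ h)).norm.const_mul ((2 ^ h : ℕ) : ℝ))
      simp only [norm_zero, mul_zero] at h0
      refine squeeze_zero_norm (fun n => ?_) h0
      refine norm_pow_sub_pow_le (hf _ _ _) ?_ _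
      rw [norm_pow]
      exact pow_le_one₀ (norm_nonneg _) (hf _ _ _)
    have := ih.add hlim
    rw [add_zero] at this
    refine this.congr fun n => ?_
    have e1 : t / √2 ^ h / √2 = t / √2 ^ (h + 1) := by rw [div_div, pow_succ]
    rw [e1, ← pow_mul, show 2 * 2 ^ h = 2 ^ (h + 1) by ring, add_assoc]
    ring

theorem sq_div_sqrt_two_pow (t : ℝ) (h : ℕ) : (t / √2 ^ h) ^ 2 = t ^ 2 / 2 ^ h := by
  rw [div_pow, ← pow_mul, mul_comm h, pow_mul, Real.sq_sqrt (by norm_num)]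

/-- Since (t/√2^h)² = t²/2^h, this is (1 + z/m)^m → exp z along m = 2^h, with z = -t²/2. -/
theorem tendsto_one_sub_pow_two_pow (t : ℝ) :
    Tendsto (fun h : ℕ => (1 - ((t / √2 ^ h : ℝ) : ℂ) ^ 2 / 2) ^ 2 ^ h) atTop
      (𝓝 (Complex.exp (-(t ^ 2 / 2)))) := by
  have h1 := (Complex.tendsto_one_add_div_pow_exp (-((t : ℂ) ^ 2 / 2))).comp
    (tendsto_pow_atTop_atTop_of_one_lt (one_lt_two : (1 : ℕ) < 2))
  refine h1.congr fun h => ?_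
  simp only [Function.comp_apply]
  congr 1
  rw [← Complex.ofReal_pow (t / √2 ^ h) 2, sq_div_sqrt_two_pow]
  push_cast
  ring

/-- A central limit theorem for families of characteristic functions related by asymptotic
halving, under a Lindeberg type bound that improves with the level. -/
theorem tendsto_exp_of_halving (hf : ∀ r n t, ‖f r n t‖ ≤ 1)
    (hrec : ∀ r t, Tendsto (fun n => f r n t - f (r + 1) n (t / √2) ^ 2) atTop (𝓝 0))
    {ε : ℕ → ℝ} (hε : Tendsto ε atTop (𝓝 0))
    (hT : ∀ k s, ∀ᶠ n in atTop, ‖f k n s - (1 - (s : ℂ) ^ 2 / 2)‖ ≤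
      4 * (s ^ 2 * ε k + |s| ^ 3 * (2 : ℝ) ^ ((k : ℝ) / 4))) (r : ℕ) (t : ℝ) :
    Tendsto (f r · t) atTop (𝓝 (Complex.exp (-(t ^ 2 / 2)))) := by
  -- With q = 2^(1/4), the truncation level is q^k, √2 = q² and 2 = q⁴, so all error terms become
  -- integer powers of q.
  set q : ℝ := (2 : ℝ) ^ ((1 : ℝ) / 4) with hq
  have hq0 : 0 < q := by positivity
  have hq4 : q ^ 4 = 2 := by
    rw [hq, ← Real.rpow_natCast, ← Real.rpow_mul (by norm_num)]; norm_num
  have hq2 : √2 = q ^ 2 := by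
    rw [Real.sqrt_eq_iff_mul_self_eq (by norm_num) (by positivity)]; rw [← hq4]; ring
  have hq1 : 1 < q := by
    by_contra hcon
    have := pow_le_one₀ (n := 4) hq0.le (not_lt.1 hcon)
    linarith
  have hqk : ∀ k : ℕ, (2 : ℝ) ^ ((k : ℝ) / 4) = q ^ k := fun k => by
    rw [hq, ← Real.rpow_natCast, ← Real.rpow_mul (by norm_num)]; congr 1; ring
  -- This is 2^h times the expansion error at s = t/√2^h. In the cubic term the powers of q combine
  -- as q^(4h) q^(-6h) q^(r+h) = q^r q^(-h).
  have hbound : Tendsto (fun h : ℕ => 4 * (t ^ 2 * ε (r + h) + |t| ^ 3 * q ^ r * (q⁻¹) ^ h)) atTop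
      (𝓝 0) := by
    have h1 : Tendsto (fun h : ℕ => ε (r + h)) atTop (𝓝 0) := by
      have := (tendsto_add_atTop_iff_nat r).2 hε
      simpa [add_comm] using this
    have h2 := tendsto_pow_atTop_nhds_zero_of_lt_one (inv_nonneg.2 hq0.le) (inv_lt_one_of_one_lt₀ hq1)
    have := ((h1.const_mul (t ^ 2)).add (h2.const_mul (|t| ^ 3 * q ^ r))).const_mul 4
    simpa using this
  rw [Metric.tendsto_atTop']
  intro η hη
  -- Then s² ≤ 4, so 1 - s²/2 lies in [-1, 1], as comparing its 2^h-th power with that of the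
  -- characteristic function requires.
  have hev : ∀ᶠ h : ℕ in atTop, t ^ 2 / 2 ^ h ≤ 4 := by
    have h2 : Tendsto (fun h : ℕ => t ^ 2 * ((2 : ℝ)⁻¹) ^ h) atTop (𝓝 0) := by
      simpa using (tendsto_pow_atTop_nhds_zero_of_lt_one (r := (2 : ℝ)⁻¹) (by norm_num)
        (by norm_num)).const_mul (t ^ 2)
    filter_upwards [h2.eventually (ge_mem_nhds (show (0 : ℝ) < 4 by norm_num))] with h hh
    rwa [inv_pow, ← div_eq_mul_inv] at hh
  -- The depth h is fixed here, before n; only then does n go to infinity in the iterated relation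
  -- and the expansion at level r + h.
  obtain ⟨h, hh1, hh2, hh3⟩ := ((hbound.eventually (gt_mem_nhds (show (0 : ℝ) < η / 3 by linarith))).and
    ((Metric.tendsto_nhds.1 (tendsto_one_sub_pow_two_pow t) (η / 3) (by linarith)).and hev)).exists
  set s : ℝ := t / √2 ^ h with hs
  have hs2 : s ^ 2 = t ^ 2 / 2 ^ h := sq_div_sqrt_two_pow t h
  have hw : ‖(1 - (s : ℂ) ^ 2 / 2)‖ ≤ 1 := by
    rw [← Complex.ofReal_pow, hs2]
    have e : (1 - ((t ^ 2 / 2 ^ h : ℝ) : ℂ) / 2) = ((1 - t ^ 2 / 2 ^ h / 2 : ℝ) : ℂ) := by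
      push_cast; ring
    rw [e, Complex.norm_real, Real.norm_eq_abs, abs_le]
    have : 0 ≤ t ^ 2 / 2 ^ h := by positivity
    constructor <;> linarith
  have h3 := Metric.tendsto_nhds.1 (tendsto_sub_iterate hf hrec r h t) (η / 3) (by linarith)
  obtain ⟨n₀, hn₀⟩ := eventually_atTop.1 (h3.and (hT (r + h) s))
  refine ⟨n₀, fun n hn => ?_⟩
  obtain ⟨b1, b2⟩ := hn₀ n hn.le
  rw [dist_zero_right] at b1
  rw [dist_eq_norm] at hh2 ⊢
  have b3 := norm_pow_sub_pow_le (hf (r + h) n s) hw (2 ^ h)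
  have b4 : ((2 ^ h : ℕ) : ℝ) * ‖f (r + h) n s - (1 - (s : ℂ) ^ 2 / 2)‖ < η / 3 := by
    refine lt_of_le_of_lt ?_ hh1
    calc _ ≤ ((2 ^ h : ℕ) : ℝ) * (4 * (s ^ 2 * ε (r + h) + |s| ^ 3 * (2 : ℝ) ^ (((r + h : ℕ) : ℝ) / 4))) := by
          gcongr
      _ = _ := by
          have a2 : |s| ^ 3 * 2 ^ h = |t| ^ 3 * (q⁻¹) ^ h * (q⁻¹) ^ h := by
            rw [hs, abs_div, abs_of_nonneg (show 0 ≤ √2 ^ h by positivity), hq2, div_pow, inv_pow,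
              ← hq4]
            have : q ^ h ≠ 0 := by positivity
            have e1 : ((q ^ 2) ^ h) ^ 3 = (q ^ h) ^ 6 := by rw [← pow_mul, ← pow_mul, ← pow_mul]; ring_nf
            have e2 : (q ^ 4) ^ h = (q ^ h) ^ 4 := by rw [← pow_mul, ← pow_mul]; ring_nf
            rw [e1, e2]
            field_simp
          have a3 : (q⁻¹) ^ h * q ^ h = 1 := by rw [← mul_pow, inv_mul_cancel₀ hq0.ne', one_pow]
          have a4 : s ^ 2 * 2 ^ h = t ^ 2 := by rw [hs2]; field_simp
          rw [hqk, pow_add]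
          push_cast
          calc _ = 4 * ((s ^ 2 * 2 ^ h) * ε (r + h) + (|s| ^ 3 * 2 ^ h) * q ^ r * q ^ h) := by ring
            _ = 4 * (t ^ 2 * ε (r + h) + |t| ^ 3 * q ^ r * (q⁻¹) ^ h * ((q⁻¹) ^ h * q ^ h)) := by
                rw [a2, a4]; ring
            _ = _ := by rw [a3, mul_one]
  have hsplit : f r n t - Complex.exp (-(t ^ 2 / 2)) =
      (f r n t - f (r + h) n s ^ 2 ^ h) + (f (r + h) n s ^ 2 ^ h - (1 - (s : ℂ) ^ 2 / 2) ^ 2 ^ h) +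
      ((1 - (s : ℂ) ^ 2 / 2) ^ 2 ^ h - Complex.exp (-(t ^ 2 / 2))) := by ring
  rw [hsplit]
  refine (norm_add₃_le).trans_lt ?_
  have := b3.trans_lt b4
  linarith

end Iteration

/-! ### Step function approximation on the cells -/

section Cells

variable (𝒥 : NestedPartitions) (k : ℕ)

theorem finite_cells : (cells 𝒥 k).Finite := by
  obtain ⟨F, hF, hcov⟩ := 𝒥.finite_cover k (-(2 : ℝ) ^ k) (2 ^ k)
  exact F.finite_toSet.subset ((isLeast_cells 𝒥 k).2 ⟨hF, hcov⟩)

/-- The finite set of indices of the cells of level `k`. -/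
noncomputable def cellFinset : Finset ℕ := (finite_cells 𝒥 k).toFinset

variable {𝒥 k}

theorem mem_cellFinset {j : ℕ} : j ∈ cellFinset 𝒥 k ↔ j ∈ cells 𝒥 k :=
  Set.Finite.mem_toFinset _

theorem measurableSet_J {j : ℕ} (hj : j ∈ cellFinset 𝒥 k) : MeasurableSet (𝒥.J k j) :=
  (𝒥.ordConnected k j (mem_cellFinset.1 hj).1).measurableSet

theorem measurableSet_cellAlgebra_J {j : ℕ} (hj : j ∈ cellFinset 𝒥 k) :
    MeasurableSet[cellAlgebra 𝒥 k] (𝒥.J k j) :=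
  MeasurableSpace.measurableSet_generateFrom ⟨j, mem_cellFinset.1 hj, rfl⟩

theorem abs_sub_le_of_mem_J {j : ℕ} (hj : j ∈ cellFinset 𝒥 k) {x y : ℝ} (hx : x ∈ 𝒥.J k j)
    (hy : y ∈ 𝒥.J k j) : |x - y| ≤ (4 : ℝ)⁻¹ ^ k := by
  have hj' := (mem_cellFinset.1 hj).1
  wlog h : y ≤ x generalizing x y
  · rw [abs_sub_comm]; exact this hy hx (le_of_not_ge h)
  have h1 : volume (Icc y x) ≤ volume (𝒥.J k j) :=
    measure_mono ((𝒥.ordConnected k j hj').out hy hx)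
  rw [𝒥.length_eq k j hj', Real.volume_Icc,
    ENNReal.ofReal_le_ofReal_iff (by positivity)] at h1
  rwa [abs_of_nonneg (sub_nonneg.2 h)]

variable (𝒥 k)

/-- The union of the cells of level `k`. -/
def cellUnion : Set ℝ := ⋃ j ∈ cellFinset 𝒥 k, 𝒥.J k j

variable {𝒥 k}

theorem measurableSet_cellAlgebra_cellUnion : MeasurableSet[cellAlgebra 𝒥 k] (cellUnion 𝒥 k) :=
  Finset.measurableSet_biUnion (m := cellAlgebra 𝒥 k) _ fun _ hj => measurableSet_cellAlgebra_J hj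

theorem measurableSet_cellUnion : MeasurableSet (cellUnion 𝒥 k) :=
  Finset.measurableSet_biUnion _ fun _ hj => measurableSet_J hj

theorem Icc_subset_cellUnion : Icc (-(2 : ℝ) ^ k) (2 ^ k) ⊆ cellUnion 𝒥 k := by
  intro x hx
  have := (isLeast_cells 𝒥 k).1.2 hx
  simp only [cellUnion, mem_iUnion, mem_cellFinset] at this ⊢
  exact this

variable (𝒥 k)

/-- The step function with value `c j` on the cell `j` and `0` outside the cells. -/
noncomputable def cellStep (c : ℕ → ℂ) (x : ℝ) : ℂ :=
  ∑ j ∈ cellFinset 𝒥 k, (𝒥.J k j).indicator (fun _ => c j) x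

variable {𝒥 k}

theorem cellStep_of_mem (c : ℕ → ℂ) {j : ℕ} (hj : j ∈ cellFinset 𝒥 k) {x : ℝ}
    (hx : x ∈ 𝒥.J k j) : cellStep 𝒥 k c x = c j := by
  unfold cellStep
  rw [Finset.sum_eq_single_of_mem j hj, indicator_of_mem hx]
  intro i hi hij
  refine indicator_of_notMem (fun hxi => ?_) _
  exact Set.disjoint_left.1 (𝒥.pairwiseDisjoint k (mem_cellFinset.1 hi).1
    (mem_cellFinset.1 hj).1 hij) hxi hx

theorem cellStep_of_notMem (c : ℕ → ℂ) {x : ℝ} (hx : x ∉ cellUnion 𝒥 k) :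
    cellStep 𝒥 k c x = 0 := by
  refine Finset.sum_eq_zero fun j hj => indicator_of_notMem (fun hxj => hx ?_) _
  exact mem_biUnion (by exact hj) hxj

theorem norm_cellStep_le {c : ℕ → ℂ} (hc : ∀ j, ‖c j‖ ≤ 1) (x : ℝ) : ‖cellStep 𝒥 k c x‖ ≤ 1 := by
  by_cases hx : x ∈ cellUnion 𝒥 k
  · simp only [cellUnion, mem_iUnion] at hx
    obtain ⟨j, hj, hxj⟩ := hx
    rw [cellStep_of_mem c hj hxj]; exact hc j
  · rw [cellStep_of_notMem c hx]; simp

theorem measurable_cellStep (c : ℕ → ℂ) : Measurable (cellStep 𝒥 k c) :=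
  Finset.measurable_fun_sum _ fun _ hj => measurable_const.indicator (measurableSet_J hj)

/-- On a cell the |t|-Lipschitz character varies by at most |t| 4^(-k). Off the cells the step
function is 0, so the error has modulus 1. -/
theorem norm_expChar_sub_cellStep_le {p : ℕ → ℝ} (hp : ∀ j ∈ cellFinset 𝒥 k, p j ∈ 𝒥.J k j)
    (t x : ℝ) :
    ‖expChar t x - cellStep 𝒥 k (fun j => expChar t (p j)) x‖ ≤
      |t| * (4 : ℝ)⁻¹ ^ k + (cellUnion 𝒥 k)ᶜ.indicator 1 x := by
  by_cases hx : x ∈ cellUnion 𝒥 k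
  · rw [indicator_of_notMem (by simpa using hx), add_zero]
    simp only [cellUnion, mem_iUnion] at hx
    obtain ⟨j, hj, hxj⟩ := hx
    rw [cellStep_of_mem _ hj hxj]
    refine (norm_expChar_sub_le _ _ _).trans ?_
    exact mul_le_mul_of_nonneg_left (abs_sub_le_of_mem_J hj hxj (hp j hj)) (abs_nonneg _)
  · rw [indicator_of_mem (by simpa using hx), cellStep_of_notMem _ hx, sub_zero, norm_expChar]
    simp only [Pi.one_apply, le_add_iff_nonneg_left]
    positivity

theorem exists_cell_points (𝒥 : NestedPartitions) (k : ℕ) :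
    ∃ p : ℕ → ℝ, ∀ j ∈ cellFinset 𝒥 k, p j ∈ 𝒥.J k j := by
  have : ∀ j, ∃ x, j ∈ cellFinset 𝒥 k → x ∈ 𝒥.J k j := fun j => by
    by_cases hj : j ∈ cellFinset 𝒥 k
    · obtain ⟨_, x, hx, _⟩ := mem_cellFinset.1 hj
      exact ⟨x, fun _ => hx⟩
    · exact ⟨0, fun h => absurd h hj⟩
  choose p hp using this
  exact ⟨p, hp⟩

variable {Ω : Type*} [MeasurableSpace Ω] {P : Measure Ω} [IsProbabilityMeasure P]
  {A B : Ω → ℝ}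

theorem integrable_cellStep (hA : Measurable A) {c : ℕ → ℂ} (hc : ∀ j, ‖c j‖ ≤ 1) :
    Integrable (fun ω => cellStep 𝒥 k c (A ω)) P :=
  Integrable.of_bound (C := 1) ((measurable_cellStep c).comp hA).aestronglyMeasurable
    (Eventually.of_forall fun _ => norm_cellStep_le hc _)

theorem integrable_cellStep_mul (hA : Measurable A) (hB : Measurable B) {c : ℕ → ℂ}
    (hc : ∀ j, ‖c j‖ ≤ 1) :
    Integrable (fun ω => cellStep 𝒥 k c (A ω) * cellStep 𝒥 k c (B ω)) P :=
  Integrable.of_bound (C := 1)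
    (((measurable_cellStep c).comp hA).mul ((measurable_cellStep c).comp hB)).aestronglyMeasurable
    (Eventually.of_forall fun _ => by
      rw [norm_mul]
      exact mul_le_one₀ (norm_cellStep_le hc _) (norm_nonneg _) (norm_cellStep_le hc _))

theorem integral_cellStep (hA : Measurable A) (c : ℕ → ℂ) :
    ∫ ω, cellStep 𝒥 k c (A ω) ∂P =
      ∑ j ∈ cellFinset 𝒥 k, (P.real {ω | A ω ∈ 𝒥.J k j} : ℂ) * c j := by
  have h : ∀ j ω, (𝒥.J k j).indicator (fun _ => c j) (A ω) =
    ({ω | A ω ∈ 𝒥.J k j}).indicator (fun _ => c j) ω := fun j ω => rfl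
  unfold cellStep
  simp_rw [h]
  rw [integral_finsetSum]
  · refine Finset.sum_congr rfl fun j hj => ?_
    rw [integral_indicator_const (μ := P) (s := {ω | A ω ∈ 𝒥.J k j}) _ (hA (measurableSet_J hj))]
    simp
  · exact fun j hj => (integrable_const _).indicator (hA (measurableSet_J hj))

theorem integral_cellStep_mul (hA : Measurable A) (hB : Measurable B) (c : ℕ → ℂ) :
    ∫ ω, cellStep 𝒥 k c (A ω) * cellStep 𝒥 k c (B ω) ∂P =
      ∑ i ∈ cellFinset 𝒥 k, ∑ j ∈ cellFinset 𝒥 k,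
        (P.real {ω | A ω ∈ 𝒥.J k i ∧ B ω ∈ 𝒥.J k j} : ℂ) * (c i * c j) := by
  have h : ∀ i j ω, (𝒥.J k i).indicator (fun _ => c i) (A ω) *
      (𝒥.J k j).indicator (fun _ => c j) (B ω) =
    ({ω | A ω ∈ 𝒥.J k i ∧ B ω ∈ 𝒥.J k j}).indicator (fun _ => c i * c j) ω := fun i j ω => by
    by_cases h1 : A ω ∈ 𝒥.J k i <;> by_cases h2 : B ω ∈ 𝒥.J k j <;> simp [indicator, h1, h2]
  have hm : ∀ i ∈ cellFinset 𝒥 k, ∀ j ∈ cellFinset 𝒥 k,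
      MeasurableSet {ω | A ω ∈ 𝒥.J k i ∧ B ω ∈ 𝒥.J k j} := fun i hi j hj =>
    (hA (measurableSet_J hi)).inter (hB (measurableSet_J hj))
  unfold cellStep
  simp_rw [Finset.sum_mul_sum, h]
  rw [integral_finsetSum]
  · refine Finset.sum_congr rfl fun i hi => ?_
    rw [integral_finsetSum]
    · refine Finset.sum_congr rfl fun j hj => ?_
      rw [integral_indicator_const _ (hm i hi j hj)]
      simp
    · exact fun j hj => (integrable_const _).indicator (hm i hi j hj)
  · exact fun i hi => integrable_finsetSum _ fun j hj =>
      (integrable_const _).indicator (hm i hi j hj)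

theorem integrable_indicator_compl_cellUnion (hA : Measurable A) :
    Integrable (fun ω => (cellUnion 𝒥 k)ᶜ.indicator (1 : ℝ → ℝ) (A ω)) P := by
  have : (fun ω => (cellUnion 𝒥 k)ᶜ.indicator (1 : ℝ → ℝ) (A ω)) =
    (A ⁻¹' (cellUnion 𝒥 k)ᶜ).indicator 1 := rfl
  rw [this]
  exact (integrable_const (1 : ℝ)).indicator (hA measurableSet_cellUnion.compl)

theorem integral_bound_eq (hA : Measurable A) (a : ℝ) :
    ∫ ω, (a + (cellUnion 𝒥 k)ᶜ.indicator (1 : ℝ → ℝ) (A ω)) ∂P =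
      a + P.real {ω | A ω ∉ cellUnion 𝒥 k} := by
  have : (fun ω => (cellUnion 𝒥 k)ᶜ.indicator (1 : ℝ → ℝ) (A ω)) =
    (A ⁻¹' (cellUnion 𝒥 k)ᶜ).indicator 1 := rfl
  rw [integral_add (integrable_const _) (integrable_indicator_compl_cellUnion hA), this,
    integral_indicator_one (hA measurableSet_cellUnion.compl)]
  simp
  rfl

theorem norm_integral_expChar_sub_cellStep_le (hA : Measurable A) {p : ℕ → ℝ}
    (hp : ∀ j ∈ cellFinset 𝒥 k, p j ∈ 𝒥.J k j) (t : ℝ) :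
    ‖∫ ω, expChar t (A ω) ∂P - ∫ ω, cellStep 𝒥 k (fun j => expChar t (p j)) (A ω) ∂P‖ ≤
      |t| * (4 : ℝ)⁻¹ ^ k + P.real {ω | A ω ∉ cellUnion 𝒥 k} := by
  rw [← integral_sub (integrable_expChar hA.aemeasurable t)
    (integrable_cellStep hA fun j => (norm_expChar _ _).le), ← integral_bound_eq hA]
  exact norm_integral_le_of_norm_le
    ((integrable_const _).add (integrable_indicator_compl_cellUnion hA))
    (Eventually.of_forall fun ω => norm_expChar_sub_cellStep_le hp t (A ω))

theorem norm_integral_expChar_add_sub_cellStep_le (hA : Measurable A) (hB : Measurable B)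
    {p : ℕ → ℝ} (hp : ∀ j ∈ cellFinset 𝒥 k, p j ∈ 𝒥.J k j) (t : ℝ) :
    ‖∫ ω, expChar t (A ω + B ω) ∂P - ∫ ω, cellStep 𝒥 k (fun j => expChar t (p j)) (A ω) *
        cellStep 𝒥 k (fun j => expChar t (p j)) (B ω) ∂P‖ ≤
      (|t| * (4 : ℝ)⁻¹ ^ k + P.real {ω | A ω ∉ cellUnion 𝒥 k}) +
      (|t| * (4 : ℝ)⁻¹ ^ k + P.real {ω | B ω ∉ cellUnion 𝒥 k}) := by
  have hc : ∀ j, ‖(fun j => expChar t (p j)) j‖ ≤ 1 := fun j => (norm_expChar _ _).le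
  have hi : ∀ {C : Ω → ℝ}, Measurable C → Integrable (fun ω => |t| * (4 : ℝ)⁻¹ ^ k +
      (cellUnion 𝒥 k)ᶜ.indicator (1 : ℝ → ℝ) (C ω)) P := fun hC =>
    (integrable_const _).add (integrable_indicator_compl_cellUnion hC)
  rw [← integral_sub (integrable_expChar (A := fun ω => A ω + B ω) (hA.add hB).aemeasurable t)
    (integrable_cellStep_mul hA hB hc), ← integral_bound_eq hA, ← integral_bound_eq hB,
    ← integral_add (hi hA) (hi hB)]
  refine norm_integral_le_of_norm_le ((hi hA).add (hi hB)) (Eventually.of_forall fun ω => ?_)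
  set g := cellStep 𝒥 k (fun j => expChar t (p j)) with hg
  -- One factor is replaced at a time, the other being bounded by 1.
  have e : expChar t (A ω + B ω) - g (A ω) * g (B ω) =
      (expChar t (A ω) - g (A ω)) * expChar t (B ω) + g (A ω) * (expChar t (B ω) - g (B ω)) := by
    rw [expChar_add]; ring
  rw [e]
  refine (norm_add_le _ _).trans (add_le_add ?_ ?_)
  · rw [norm_mul, norm_expChar, mul_one]
    exact norm_expChar_sub_cellStep_le hp t (A ω)
  · rw [norm_mul]
    refine (mul_le_of_le_one_left (norm_nonneg _) (norm_cellStep_le hc _)).trans ?_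
    exact norm_expChar_sub_cellStep_le hp t (B ω)

/-- The characteristic function of the sum of two variables is close to the square of that of the
first, if on the cells they are nearly independent and nearly equidistributed. -/
theorem norm_integral_expChar_add_sub_sq_le (hA : Measurable A) (hB : Measurable B)
    (hA2 : MemLp A 2 P) (h1 : ∫ ω, A ω ^ 2 ∂P ≤ 1) {δI δS : ℝ}
    (hI : ∀ C C' : Set ℝ, MeasurableSet[cellAlgebra 𝒥 k] C → MeasurableSet[cellAlgebra 𝒥 k] C' →
      |P.real {ω | A ω ∈ C ∧ B ω ∈ C'} - P.real {ω | A ω ∈ C} * P.real {ω | B ω ∈ C'}| ≤ δI)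
    (hS : ∀ C : Set ℝ, MeasurableSet[cellAlgebra 𝒥 k] C →
      |P.real {ω | A ω ∈ C} - P.real {ω | B ω ∈ C}| ≤ δS) (t : ℝ) :
    ‖∫ ω, expChar t (A ω + B ω) ∂P - (∫ ω, expChar t (A ω) ∂P) ^ 2‖ ≤
      4 * (|t| + 1) * (4 : ℝ)⁻¹ ^ k + (δS + (cellFinset 𝒥 k).card ^ 2 * δI +
        (cellFinset 𝒥 k).card * δS) := by
  obtain ⟨p, hp⟩ := exists_cell_points 𝒥 k
  set c : ℕ → ℂ := fun j => expChar t (p j) with hcdef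
  have hc : ∀ j, ‖c j‖ = 1 := fun j => norm_expChar _ _
  have hc' : ∀ j, ‖c j‖ ≤ 1 := fun j => (hc j).le
  -- Off the cells |A| > 2^k, so Chebyshev's inequality applies to A² at level 4^k.
  have hPA : P.real {ω | A ω ∉ cellUnion 𝒥 k} ≤ (4 : ℝ)⁻¹ ^ k := by
    have hmk := mul_meas_ge_le_integral_of_nonneg (μ := P) (f := fun ω => A ω ^ 2)
      (Eventually.of_forall fun ω => sq_nonneg _) hA2.integrable_sq ((4 : ℝ) ^ k)
    have hsub : P.real {ω | A ω ∉ cellUnion 𝒥 k} ≤ P.real {ω | (4 : ℝ) ^ k ≤ A ω ^ 2} := by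
      refine measureReal_mono fun ω hω => ?_
      by_contra hcon
      refine hω (Icc_subset_cellUnion ?_)
      rw [Set.mem_ofPred_eq, not_le, show (4 : ℝ) ^ k = (2 ^ k) ^ 2 by
        rw [← pow_mul, mul_comm, pow_mul]; norm_num] at hcon
      exact abs_le.1 (abs_le_of_sq_le_sq hcon.le (by positivity))
    rw [inv_pow]
    refine hsub.trans ?_
    rw [← one_div, le_div_iff₀ (by positivity), mul_comm]
    exact hmk.trans h1
  have hcompl : ∀ {C : Ω → ℝ}, Measurable C → P.real {ω | C ω ∉ cellUnion 𝒥 k} =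
      1 - P.real {ω | C ω ∈ cellUnion 𝒥 k} := fun hC =>
    probReal_compl_eq_one_sub (hC measurableSet_cellUnion)
  -- No moment of B is controlled; its tail is compared with that of A, the union of the cells being
  -- itself in the cell algebra.
  have hPB : P.real {ω | B ω ∉ cellUnion 𝒥 k} ≤ (4 : ℝ)⁻¹ ^ k + δS := by
    have h2 := (abs_le.1 (hS _ (measurableSet_cellAlgebra_cellUnion (𝒥 := 𝒥) (k := k)))).2
    rw [hcompl hA] at hPA
    rw [hcompl hB]
    linarith
  set GA := ∫ ω, cellStep 𝒥 k c (A ω) ∂P with hGA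
  set GB := ∫ ω, cellStep 𝒥 k c (B ω) ∂P with hGB
  set GAB := ∫ ω, cellStep 𝒥 k c (A ω) * cellStep 𝒥 k c (B ω) ∂P with hGAB
  set φ := ∫ ω, expChar t (A ω) ∂P with hφ
  have b1 := norm_integral_expChar_add_sub_cellStep_le (P := P) hA hB hp t
  have b2 : ‖GAB - GA * GB‖ ≤ (cellFinset 𝒥 k).card ^ 2 * δI := by
    rw [hGAB, hGA, hGB, integral_cellStep_mul hA hB, integral_cellStep hA, integral_cellStep hB,
      Finset.sum_mul_sum, ← Finset.sum_sub_distrib]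
    have : ∀ i ∈ cellFinset 𝒥 k, ‖∑ j ∈ cellFinset 𝒥 k,
        (P.real {ω | A ω ∈ 𝒥.J k i ∧ B ω ∈ 𝒥.J k j} : ℂ) * (c i * c j) -
        ∑ j ∈ cellFinset 𝒥 k, (P.real {ω | A ω ∈ 𝒥.J k i} : ℂ) * c i *
          ((P.real {ω | B ω ∈ 𝒥.J k j} : ℂ) * c j)‖ ≤ (cellFinset 𝒥 k).card * δI := by
      intro i hi
      rw [← Finset.sum_sub_distrib, ← nsmul_eq_mul, ← Finset.sum_const]
      refine norm_sum_le_of_le _ fun j hj => ?_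
      have := hI _ _ (measurableSet_cellAlgebra_J hi) (measurableSet_cellAlgebra_J hj)
      have e : (P.real {ω | A ω ∈ 𝒥.J k i ∧ B ω ∈ 𝒥.J k j} : ℂ) * (c i * c j) -
          (P.real {ω | A ω ∈ 𝒥.J k i} : ℂ) * c i * ((P.real {ω | B ω ∈ 𝒥.J k j} : ℂ) * c j) =
          ((P.real {ω | A ω ∈ 𝒥.J k i ∧ B ω ∈ 𝒥.J k j} - P.real {ω | A ω ∈ 𝒥.J k i} *
            P.real {ω | B ω ∈ 𝒥.J k j} : ℝ) : ℂ) * (c i * c j) := by push_cast; ring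
      rw [e, norm_mul, norm_mul, hc, hc, Complex.norm_real, Real.norm_eq_abs]
      simpa using this
    refine (norm_sum_le_of_le _ this).trans ?_
    rw [Finset.sum_const, nsmul_eq_mul]
    exact le_of_eq (by ring)
  have b3 : ‖GB - GA‖ ≤ (cellFinset 𝒥 k).card * δS := by
    rw [hGA, hGB, integral_cellStep hA, integral_cellStep hB, ← Finset.sum_sub_distrib,
      ← nsmul_eq_mul, ← Finset.sum_const]
    refine norm_sum_le_of_le _ fun j hj => ?_
    have := hS _ (measurableSet_cellAlgebra_J hj)
    rw [← sub_mul, norm_mul, hc, mul_one, ← Complex.ofReal_sub, Complex.norm_real,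
      Real.norm_eq_abs, abs_sub_comm]
    exact this
  have b4 : ‖φ - GA‖ ≤ |t| * (4 : ℝ)⁻¹ ^ k + P.real {ω | A ω ∉ cellUnion 𝒥 k} :=
    norm_integral_expChar_sub_cellStep_le hA hp t
  have n1 : ‖GA‖ ≤ 1 := by
    have := norm_integral_le_of_norm_le_const (μ := P) (f := fun ω => cellStep 𝒥 k c (A ω))
      (C := 1) (Eventually.of_forall fun ω => norm_cellStep_le hc' _)
    simpa using this
  have n2 : ‖φ‖ ≤ 1 := norm_integral_expChar_le A t
  -- Discretize, decouple, replace B by A, and return from the step function to the character. The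
  -- first and last moves each cost 2(|t| + 1) 4^(-k), the first also a δS from the tail of B.
  have e : ∫ ω, expChar t (A ω + B ω) ∂P - φ ^ 2 =
      (∫ ω, expChar t (A ω + B ω) ∂P - GAB) + (GAB - GA * GB) + GA * (GB - GA)
        + -((φ - GA) * (φ + GA)) := by ring
  have b5 : ‖GA * (GB - GA)‖ ≤ (cellFinset 𝒥 k).card * δS := by
    rw [norm_mul]
    exact (mul_le_of_le_one_left (norm_nonneg _) n1).trans b3
  have b6 : ‖-((φ - GA) * (φ + GA))‖ ≤ (|t| * (4 : ℝ)⁻¹ ^ k + (4 : ℝ)⁻¹ ^ k) * 2 := by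
    rw [norm_neg, norm_mul]
    refine mul_le_mul (b4.trans (by linarith)) ((norm_add_le _ _).trans (by linarith))
      (norm_nonneg _) (by positivity)
  rw [e]
  refine (norm_add₄_le).trans ?_
  linarith

end Cells

/-! ### Growth of the block lengths -/

section BlockLengths

variable {τ : ℕ → ℕ}

theorem one_le_blockLen (hτ : IsGapSequence τ) (n : ℕ) : 1 ≤ blockLen τ n := by
  by_cases hn : n ≤ 1
  · simp [blockLen, hn]
  · exact (isGreatest_blockLen hτ (by omega)).1.1

theorem blockLen_le (hτ : IsGapSequence τ) {n : ℕ} (hn : 1 ≤ n) : blockLen τ n ≤ n := by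
  by_cases hn' : n ≤ 1
  · simp [blockLen, hn', hn]
  · have := block_add_gap_add_block hτ (n := n) (by omega)
    omega

/-- Each fixed length m + 1 is admissible once n reaches 2(m + 1) + τ(m + 1), and the maximum
dominates it. -/
theorem tendsto_blockLen (hτ : IsGapSequence τ) : Tendsto (blockLen τ) atTop atTop := by
  rw [tendsto_atTop]
  intro m
  filter_upwards [eventually_ge_atTop (2 * (m + 1) + τ (m + 1))] with n hn
  have hm : m + 1 ∈ {m : ℕ | 1 ≤ m ∧ 2 * m + τ m ≤ n} := ⟨by omega, hn⟩
  have := (isGreatest_blockLen hτ (n := n) (by omega)).2 hm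
  omega

theorem iterBlock_succ (τ N : ℕ → ℕ) (r n : ℕ) :
    iterBlock τ N (r + 1) n = blockLen τ (iterBlock τ N r n) :=
  Function.iterate_succ_apply' _ _ _

end BlockLengths

/-! ### The asymptotic halving relation for the array -/

section Array

variable {Ω : Type*} [MeasurableSpace Ω] {P : Measure Ω} {τ N : ℕ → ℕ} {X : ℕ → ℕ → Ω → ℝ}
  {σ : ℕ → ℕ → ℝ} {𝒥 : NestedPartitions}

/-- A real `sSup` dominates its set only if the set is bounded above; here 1 is a bound, as both
terms of the difference lie in [0, 1]. -/
theorem le_depCoeff [IsProbabilityMeasure P] {k h n n' r : ℕ} (hn : n ≤ n') (hr : 1 ≤ r) (hrh : r ≤ h)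
    (hm : 1 < iterBlock τ N r n') {B B' : Set ℝ} (hB : MeasurableSet[cellAlgebra 𝒥 k] B)
    (hB' : MeasurableSet[cellAlgebra 𝒥 k] B') :
    |P.real {ω | blockSum τ N X σ r n' ω ∈ B ∧ blockSum' τ N X σ r n' ω ∈ B'} -
        P.real {ω | blockSum τ N X σ r n' ω ∈ B} * P.real {ω | blockSum' τ N X σ r n' ω ∈ B'}| ≤
      depCoeff P τ N X σ 𝒥 k h n := by
  refine le_csSup ⟨1, ?_⟩ ⟨n', r, hn, hr, hrh, hm, B, B', hB, hB', rfl⟩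
  rintro _ ⟨n', r, -, -, -, -, B, B', -, -, rfl⟩
  have h0 : ∀ s : Set Ω, 0 ≤ P.real s := fun s => measureReal_nonneg
  have h1 : ∀ s : Set Ω, P.real s ≤ 1 := fun s => measureReal_le_one
  refine abs_sub_le_of_nonneg_of_le (h0 _) (h1 _) (mul_nonneg (h0 _) (h0 _)) ?_
  exact mul_le_one₀ (h1 _) (h0 _) (h1 _)

theorem le_statCoeff [IsProbabilityMeasure P] {k h n n' r : ℕ} (hn : n ≤ n') (hr : 1 ≤ r) (hrh : r ≤ h)
    (hm : 1 < iterBlock τ N r n') {B : Set ℝ} (hB : MeasurableSet[cellAlgebra 𝒥 k] B) :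
    |P.real {ω | blockSum τ N X σ r n' ω ∈ B} - P.real {ω | blockSum' τ N X σ r n' ω ∈ B}| ≤
      statCoeff P τ N X σ 𝒥 k h n := by
  refine le_csSup ⟨1, ?_⟩ ⟨n', r, hn, hr, hrh, hm, B, hB, rfl⟩
  rintro _ ⟨n', r, -, -, -, -, B, -, rfl⟩
  exact abs_sub_le_of_nonneg_of_le measureReal_nonneg measureReal_le_one measureReal_nonneg
    measureReal_le_one

namespace ArrayAssumptions

variable (hX : ArrayAssumptions P τ N X σ 𝒥)
include hX

theorem one_le_iterBlock (r n : ℕ) : 1 ≤ iterBlock τ N r n := by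
  cases r with
  | zero => exact hX.one_le_N n
  | succ r => rw [iterBlock_succ]; exact one_le_blockLen hX.gap _

theorem iterBlock_le (r n : ℕ) : iterBlock τ N r n ≤ N n := by
  induction r with
  | zero => exact le_rfl
  | succ r ih =>
    rw [iterBlock_succ]
    exact (blockLen_le hX.gap (hX.one_le_iterBlock r n)).trans ih

theorem eventually_one_lt_iterBlock (r : ℕ) : ∀ᶠ n in atTop, 1 < iterBlock τ N r n := by
  have : Tendsto (iterBlock τ N r) atTop atTop := by
    induction r with
    | zero => exact hX.tendsto_N
    | succ r ih =>
      exact ((tendsto_blockLen hX.gap).comp ih).congr fun n => (iterBlock_succ τ N r n).symm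
  exact this.eventually_gt_atTop 1

theorem one_lt_iterBlock_of_succ {r n : ℕ} (h : 1 < iterBlock τ N (r + 1) n) :
    1 < iterBlock τ N r n := by
  refine h.trans_le ?_
  rw [iterBlock_succ]
  exact blockLen_le hX.gap (hX.one_le_iterBlock r n)

theorem iterBlock_add_iterGap_add_iterBlock {r n : ℕ} (h : 1 < iterBlock τ N r n) :
    iterBlock τ N (r + 1) n + iterGap τ N (r + 1) n + iterBlock τ N (r + 1) n =
      iterBlock τ N r n := by
  rw [iterBlock_succ]
  exact block_add_gap_add_block hX.gap h

theorem measurable_blockSum (r n : ℕ) : Measurable (blockSum τ N X σ r n) := by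
  refine (Finset.measurable_fun_sum _ fun i hi => ?_).const_mul _
  rw [Finset.mem_Icc] at hi
  exact hX.measurable n i hi.1 (hi.2.trans (hX.iterBlock_le r n))

theorem measurable_gapSum {r n : ℕ} (h : 1 < iterBlock τ N r n) :
    Measurable (gapSum τ N X σ (r + 1) n) := by
  refine (Finset.measurable_fun_sum _ fun i hi => ?_).const_mul _
  rw [Finset.mem_Icc] at hi
  have h1 := hX.iterBlock_add_iterGap_add_iterBlock h
  have h2 := hX.iterBlock_le r n
  exact hX.measurable n i (by omega) (by omega)

theorem measurable_blockSum' {r n : ℕ} (h : 1 < iterBlock τ N r n) :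
    Measurable (blockSum' τ N X σ (r + 1) n) := by
  refine (Finset.measurable_fun_sum _ fun i hi => ?_).const_mul _
  rw [Finset.mem_Icc] at hi
  have h1 := hX.iterBlock_add_iterGap_add_iterBlock h
  have h2 := hX.iterBlock_le r n
  exact hX.measurable n i (by omega) (by omega)

theorem memLp_blockSum (r n : ℕ) : MemLp (blockSum τ N X σ r n) 2 P := by
  have h : MemLp (fun ω => ∑ i ∈ Finset.Icc 1 (iterBlock τ N r n), X n i ω) 2 P := by
    refine memLp_finsetSum _ fun i hi => ?_
    rw [Finset.mem_Icc] at hi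
    exact hX.memLp_two n i hi.1 (hi.2.trans (hX.iterBlock_le r n))
  exact h.const_mul _

theorem integral_blockSum [IsProbabilityMeasure P] (r n : ℕ) :
    ∫ ω, blockSum τ N X σ r n ω ∂P = 0 := by
  have hi : ∀ i ∈ Finset.Icc 1 (iterBlock τ N r n), 1 ≤ i ∧ i ≤ N n := fun i hi => by
    rw [Finset.mem_Icc] at hi
    exact ⟨hi.1, hi.2.trans (hX.iterBlock_le r n)⟩
  unfold blockSum
  rw [integral_const_mul, integral_finsetSum _ fun i h =>
    (hX.memLp_two n i (hi i h).1 (hi i h).2).integrable one_le_two,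
    Finset.sum_eq_zero fun i h => hX.mean_zero n i (hi i h).1 (hi i h).2, mul_zero]

theorem integral_blockSum_sq {r n : ℕ} (h : 1 < iterBlock τ N r n) :
    ∫ ω, blockSum τ N X σ r n ω ^ 2 ∂P = 1 := by
  have hσ := hX.sigma_pos r n h
  simp only [blockSum, mul_pow]
  rw [integral_const_mul, ← hX.sigma_sq r n h, ← mul_pow, inv_mul_cancel₀ hσ.ne', one_pow]

/-- The sum of level `r`, rescaled, splits into the two blocks and the gap of level `r + 1`. -/
theorem ratio_mul_blockSum {r n : ℕ} (h : 1 < iterBlock τ N (r + 1) n) (ω : Ω) :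
    σ r n / σ (r + 1) n * blockSum τ N X σ r n ω =
      blockSum τ N X σ (r + 1) n ω + blockSum' τ N X σ (r + 1) n ω +
        gapSum τ N X σ (r + 1) n ω := by
  have hr := hX.one_lt_iterBlock_of_succ h
  have hσ := (hX.sigma_pos r n hr).ne'
  have h1 := hX.iterBlock_add_iterGap_add_iterBlock hr
  simp only [blockSum, blockSum', gapSum]
  rw [← h1]
  set m := iterBlock τ N (r + 1) n
  set g := iterGap τ N (r + 1) n
  have e : ∀ a b c : ℕ, 1 ≤ a → a ≤ b → b ≤ c → ∑ i ∈ Finset.Icc a c, X n i ω =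
      ∑ i ∈ Finset.Icc a b, X n i ω + ∑ i ∈ Finset.Icc (b + 1) c, X n i ω := by
    intro a b c h1 h2 h3
    rw [← Finset.sum_union]
    · congr 1; ext i; simp only [Finset.mem_Icc, Finset.mem_union]; omega
    · rw [Finset.disjoint_left]; intro i; simp only [Finset.mem_Icc]; omega
  rw [e 1 (m + g) (m + g + m) le_rfl (by omega) (by omega), e 1 m (m + g) le_rfl (by omega) (by omega)]
  field_simp
  ring

variable [IsProbabilityMeasure P]

/-- The level k is fixed first, making the discretization error small uniformly in n. The number of
cells is then a constant, and the coefficients multiplied by it tend to 0. -/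
theorem tendsto_expChar_blocks (r : ℕ) (t : ℝ) :
    Tendsto (fun n => ∫ ω, expChar t (blockSum τ N X σ (r + 1) n ω +
      blockSum' τ N X σ (r + 1) n ω) ∂P - (∫ ω, expChar t (blockSum τ N X σ (r + 1) n ω) ∂P) ^ 2)
      atTop (𝓝 0) := by
  rw [Metric.tendsto_nhds]
  intro η hη
  have h4 : Tendsto (fun k : ℕ => 4 * (|t| + 1) * (4 : ℝ)⁻¹ ^ k) atTop (𝓝 0) := by
    simpa using (tendsto_pow_atTop_nhds_zero_of_lt_one (r := (4 : ℝ)⁻¹) (by norm_num)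
      (by norm_num)).const_mul (4 * (|t| + 1))
  obtain ⟨k, hk⟩ := (h4.eventually (gt_mem_nhds (show (0 : ℝ) < η / 2 by linarith))).exists
  have hI := hX.tendsto_depCoeff k (r + 1)
  have hS := hX.tendsto_statCoeff k (r + 1)
  have hlim := (hS.add (hI.const_mul ((cellFinset 𝒥 k).card ^ 2 : ℝ))).add
    (hS.const_mul ((cellFinset 𝒥 k).card : ℝ))
  simp only [mul_zero, add_zero] at hlim
  filter_upwards [hlim.eventually (gt_mem_nhds (show (0 : ℝ) < η / 2 by linarith)),
    hX.eventually_one_lt_iterBlock (r + 1)] with n hn hm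
  rw [dist_zero_right]
  refine (norm_integral_expChar_add_sub_sq_le (𝒥 := 𝒥) (k := k) (hX.measurable_blockSum (r + 1) n)
    (hX.measurable_blockSum' (hX.one_lt_iterBlock_of_succ hm)) (hX.memLp_blockSum (r + 1) n)
    (hX.integral_blockSum_sq hm).le
    (fun C C' hC hC' => le_depCoeff le_rfl (Nat.le_add_left 1 r) le_rfl hm hC hC')
    (fun C hC => le_statCoeff le_rfl (Nat.le_add_left 1 r) le_rfl hm hC) t).trans_lt ?_
  linarith

/-- Adding the gap moves the character by at most |t| δ, except on an event of probability below δ,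
where it moves by at most 2. -/
theorem tendsto_expChar_gap (r : ℕ) (t : ℝ) :
    Tendsto (fun n => ∫ ω, expChar t (blockSum τ N X σ (r + 1) n ω +
        blockSum' τ N X σ (r + 1) n ω + gapSum τ N X σ (r + 1) n ω) ∂P -
      ∫ ω, expChar t (blockSum τ N X σ (r + 1) n ω + blockSum' τ N X σ (r + 1) n ω) ∂P)
      atTop (𝓝 0) := by
  obtain ⟨δ, -, hδ, hgap⟩ := hX.gap_negligible (r + 1)
  have hlim : Tendsto (fun n => |t| * δ n + 2 * δ n) atTop (𝓝 0) := by
    simpa using (hδ.const_mul |t|).add (hδ.const_mul 2)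
  refine squeeze_zero_norm' ?_ hlim
  filter_upwards [hX.eventually_one_lt_iterBlock (r + 1)] with n hm
  have hr := hX.one_lt_iterBlock_of_succ hm
  have hξ := hX.measurable_gapSum hr
  have hB : Measurable fun ω => blockSum τ N X σ (r + 1) n ω + blockSum' τ N X σ (r + 1) n ω :=
    (hX.measurable_blockSum (r + 1) n).add (hX.measurable_blockSum' hr)
  have hp := hgap n (r + 1) (Nat.le_add_left 1 r) le_rfl hm
  have hδ0 : 0 ≤ δ n := measureReal_nonneg.trans hp.le
  have hms : MeasurableSet {ω | δ n < |gapSum τ N X σ (r + 1) n ω|} :=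
    measurableSet_lt measurable_const hξ.abs
  have hbi : Integrable (fun ω => |t| * δ n +
      {ω | δ n < |gapSum τ N X σ (r + 1) n ω|}.indicator (fun _ => (2 : ℝ)) ω) P :=
    (integrable_const _).add ((integrable_const _).indicator hms)
  rw [← integral_sub (integrable_expChar (A := fun ω => blockSum τ N X σ (r + 1) n ω +
        blockSum' τ N X σ (r + 1) n ω + gapSum τ N X σ (r + 1) n ω) (hB.add hξ).aemeasurable t)
      (integrable_expChar hB.aemeasurable t)]
  refine (norm_integral_le_of_norm_le hbi (Eventually.of_forall fun ω => ?_)).trans ?_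
  · rw [expChar_add, ← mul_sub_one, norm_mul, norm_expChar, one_mul]
    by_cases h : δ n < |gapSum τ N X σ (r + 1) n ω|
    · rw [indicator_of_mem (by exact h)]
      refine (norm_expChar_sub_one_le_two _ _).trans ?_
      have : 0 ≤ |t| * δ n := by positivity
      linarith
    · rw [indicator_of_notMem (by exact h), add_zero]
      exact (norm_expChar_sub_one_le _ _).trans
        (mul_le_mul_of_nonneg_left (not_lt.1 h) (abs_nonneg _))
  · rw [integral_add (integrable_const _) ((integrable_const _).indicator hms),
      integral_indicator_const _ hms]
    simp
    linarith

/-- Asymptotically, the rescaled sum of level `r` is a sum of two independent copies of the sum of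
level `r + 1`. -/
theorem tendsto_expChar_ratio_mul (r : ℕ) (t : ℝ) :
    Tendsto (fun n => ∫ ω, expChar t (σ r n / σ (r + 1) n * blockSum τ N X σ r n ω) ∂P -
      (∫ ω, expChar t (blockSum τ N X σ (r + 1) n ω) ∂P) ^ 2) atTop (𝓝 0) := by
  have h := (hX.tendsto_expChar_gap r t).add (hX.tendsto_expChar_blocks r t)
  rw [add_zero] at h
  refine h.congr' ?_
  filter_upwards [hX.eventually_one_lt_iterBlock (r + 1)] with n hm
  simp_rw [hX.ratio_mul_blockSum hm]
  ring

/-- Unit variance gives E|S_r| ≤ 1, so φ_r is 1-Lipschitz uniformly in n, and the ratio in its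
argument may be replaced by its limit √2. -/
theorem tendsto_expChar_halving
    (hratio : ∀ r : ℕ, Tendsto (fun n : ℕ => σ r n / σ (r + 1) n) atTop (𝓝 (√2))) (r : ℕ) (t : ℝ) :
    Tendsto (fun n => ∫ ω, expChar t (blockSum τ N X σ r n ω) ∂P -
      (∫ ω, expChar (t / √2) (blockSum τ N X σ (r + 1) n ω) ∂P) ^ 2) atTop (𝓝 0) := by
  have h1 : Tendsto (fun n => ∫ ω, expChar t (blockSum τ N X σ r n ω) ∂P -
      ∫ ω, expChar (t / √2) (σ r n / σ (r + 1) n * blockSum τ N X σ r n ω) ∂P) atTop (𝓝 0) := by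
    have hlim : Tendsto (fun n => |t - t / √2 * (σ r n / σ (r + 1) n)|) atTop (𝓝 0) := by
      have := (((hratio r).const_mul (t / √2)).const_sub t).abs
      rwa [div_mul_cancel₀ _ (by positivity), sub_self, abs_zero] at this
    refine squeeze_zero_norm' ?_ hlim
    filter_upwards [hX.eventually_one_lt_iterBlock r] with n hm
    simp_rw [expChar_mul]
    refine (norm_integral_expChar_sub_le ((hX.memLp_blockSum r n).integrable one_le_two) _ _).trans ?_
    exact mul_le_of_le_one_right (abs_nonneg _)
      (integral_abs_le_one (hX.memLp_blockSum r n) (hX.integral_blockSum_sq hm).le)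
  have := h1.add (hX.tendsto_expChar_ratio_mul r (t / √2))
  rw [add_zero] at this
  exact this.congr fun n => by ring

end ArrayAssumptions

end Array

/-! ### Convergence of types and truncated second moments -/

section GaussianLimits

variable {Ω : Type*} [MeasurableSpace Ω] {P : Measure Ω} [IsProbabilityMeasure P]
  {A : ℕ → Ω → ℝ}

theorem tendsto_integral_of_tendstoInDistribution_id {γ : Measure ℝ} [IsProbabilityMeasure γ]
    (h : TendstoInDistribution A atTop (id : ℝ → ℝ) (fun _ => P) γ) {f : ℝ → ℝ}
    (hf : Continuous f) {C : ℝ} (hC : ∀ x, |f x| ≤ C) :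
    Tendsto (fun n => ∫ ω, f (A n ω) ∂P) atTop (𝓝 (∫ x, f x ∂γ)) := by
  have := ProbabilityMeasure.tendsto_iff_forall_integral_tendsto.1 h.tendsto
    (BoundedContinuousFunction.ofNormedAddCommGroup f hf C hC)
  simp only [ProbabilityMeasure.coe_mk, BoundedContinuousFunction.coe_ofNormedAddCommGroup,
    Measure.map_id] at this
  refine this.congr fun n => ?_
  rw [integral_map (h.forall_aemeasurable n) hf.aestronglyMeasurable]

theorem continuous_inv_one_add_sq (d : ℝ) : Continuous fun x : ℝ => (1 + (d * x) ^ 2)⁻¹ :=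
  Continuous.inv₀ (by fun_prop) fun x => by positivity

theorem abs_inv_one_add_sq_le (y : ℝ) : |(1 + y ^ 2)⁻¹| ≤ 1 := by
  rw [abs_of_nonneg (by positivity)]
  exact inv_le_one_of_one_le₀ (by nlinarith [sq_nonneg y])

theorem integrable_inv_one_add_sq (γ : Measure ℝ) [IsProbabilityMeasure γ] (d : ℝ) :
    Integrable (fun x : ℝ => (1 + (d * x) ^ 2)⁻¹) γ :=
  Integrable.of_bound (C := 1) (continuous_inv_one_add_sq d).aestronglyMeasurable
    (Eventually.of_forall fun _ => abs_inv_one_add_sq_le _)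

/-- The bounded continuous function 1/(1 + (d x)²) decreases strictly in d ≥ 0 for every x ≠ 0, and
the Gaussian law has no atom at 0. Its mean thus identifies a scale. -/
theorem integral_inv_one_add_sq_lt {a b : ℝ} (ha : 0 ≤ a) (hab : a < b) :
    ∫ x, (1 + (b * x) ^ 2)⁻¹ ∂(gaussianReal 0 1) < ∫ x, (1 + (a * x) ^ 2)⁻¹ ∂(gaussianReal 0 1) := by
  have hle : ∀ x : ℝ, (1 + (b * x) ^ 2)⁻¹ ≤ (1 + (a * x) ^ 2)⁻¹ := fun x => by
    have : (a * x) ^ 2 ≤ (b * x) ^ 2 := by rw [mul_pow, mul_pow]; gcongr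
    gcongr
  have hi := (integrable_inv_one_add_sq (gaussianReal 0 1) a).sub
    (integrable_inv_one_add_sq (gaussianReal 0 1) b)
  rw [← sub_pos, ← integral_sub (integrable_inv_one_add_sq _ a) (integrable_inv_one_add_sq _ b)]
  rw [integral_pos_iff_support_of_nonneg (fun x => sub_nonneg.2 (hle x)) hi]
  have hsup : ({0} : Set ℝ)ᶜ ⊆
      Function.support fun x : ℝ => (1 + (a * x) ^ 2)⁻¹ - (1 + (b * x) ^ 2)⁻¹ := by
    intro x hx
    have hx0 : x ≠ 0 := hx
    have : (a * x) ^ 2 < (b * x) ^ 2 := by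
      rw [mul_pow, mul_pow]
      have : 0 < x ^ 2 := by positivity
      gcongr
    refine (sub_pos.2 ?_).ne'
    gcongr
  have : NullSingletonClass (gaussianReal 0 1) :=
    nullSingletonClass_gaussianReal one_ne_zero
  refine lt_of_lt_of_le ?_ (measure_mono hsup)
  rw [measure_compl (measurableSet_singleton _) (measure_ne_top _ _),
    measure_singleton]
  simp

/-- Convergence of types for centred Gaussian limits. -/
theorem tendsto_scale_of_gaussian_limits {d : ℕ → ℝ} (hd : ∀ᶠ n in atTop, 0 < d n)
    (h1 : TendstoInDistribution A atTop (id : ℝ → ℝ) (fun _ => P) (gaussianReal 0 1))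
    (h2 : TendstoInDistribution (fun n ω => d n * A n ω) atTop (id : ℝ → ℝ) (fun _ => P)
      (gaussianReal 0 2)) : Tendsto d atTop (𝓝 (√2)) := by
  -- N(0,2) is the law of √2 times a standard normal, so the test means at scale d_n converge to the
  -- standard normal value at scale √2.
  have hg2 : ∫ x, (1 + (1 * x) ^ 2)⁻¹ ∂(gaussianReal 0 2) =
      ∫ x, (1 + (√2 * x) ^ 2)⁻¹ ∂(gaussianReal 0 1) := by
    have := gaussianReal_map_const_mul (μ := 0) (v := 1) (√2)
    have e : (gaussianReal 0 2) = (gaussianReal 0 1).map (√2 * ·) := by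
      rw [this]
      congr 1
      · simp
      · ext; simp
    rw [e, integral_map (by fun_prop) (continuous_inv_one_add_sq 1).aestronglyMeasurable]
    simp
  have hY := tendsto_integral_of_tendstoInDistribution_id h2 (continuous_inv_one_add_sq 1)
    (C := 1) fun _ => abs_inv_one_add_sq_le _
  simp only [one_mul] at hY hg2
  rw [hg2] at hY
  have hA : ∀ a : ℝ, Tendsto (fun n => ∫ ω, (1 + (a * A n ω) ^ 2)⁻¹ ∂P) atTop
      (𝓝 (∫ x, (1 + (a * x) ^ 2)⁻¹ ∂(gaussianReal 0 1))) := fun a =>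
    tendsto_integral_of_tendstoInDistribution_id h1 (continuous_inv_one_add_sq a) (C := 1)
      fun _ => abs_inv_one_add_sq_le _
  have hint : ∀ (n : ℕ) (a : ℝ), Integrable (fun ω => (1 + (a * A n ω) ^ 2)⁻¹) P := fun n a =>
    Integrable.of_bound (C := 1) ((continuous_inv_one_add_sq a).measurable.comp_aemeasurable
      (h1.forall_aemeasurable n)).aestronglyMeasurable
      (Eventually.of_forall fun _ => abs_inv_one_add_sq_le _)
  have hmono : ∀ (n : ℕ) {a b : ℝ}, 0 ≤ a → a ≤ b → ∫ ω, (1 + (b * A n ω) ^ 2)⁻¹ ∂P ≤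
      ∫ ω, (1 + (a * A n ω) ^ 2)⁻¹ ∂P := fun n a b ha hab => by
    refine integral_mono (hint n b) (hint n a) fun ω => ?_
    have : (a * A n ω) ^ 2 ≤ (b * A n ω) ^ 2 := by rw [mul_pow, mul_pow]; gcongr
    simp only
    gcongr
  rw [tendsto_order]
  constructor
  · intro a ha
    -- Monotonicity in the scale holds only on [0, ∞); a negative a lies below d_n by positivity.
    -- Otherwise d_n ≤ a would contradict the strict order of the limiting means.
    rcases lt_or_ge a 0 with h0 | h0
    · filter_upwards [hd] with n hn using h0.trans hn
    · filter_upwards [hd, hY.eventually_lt (hA a) (integral_inv_one_add_sq_lt h0 ha)] with n hn hlt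
      by_contra hcon
      exact absurd hlt (not_lt.2 (hmono n hn.le (not_lt.1 hcon)))
  · intro b hb
    filter_upwards [(hA b).eventually_lt hY (integral_inv_one_add_sq_lt (Real.sqrt_nonneg _) hb)]
      with n hlt
    by_contra hcon
    exact absurd hlt (not_lt.2 (hmono n ((Real.sqrt_nonneg _).trans hb.le) (not_lt.1 hcon)))

/-- The square, multiplied by a continuous cut-off supported in `[-K, K]`. -/
noncomputable def cutSq (K x : ℝ) : ℝ := x ^ 2 * max 0 (1 - |x| / K)

theorem continuous_cutSq (K : ℝ) : Continuous (cutSq K) := by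
  unfold cutSq; fun_prop

theorem cutSq_nonneg (K x : ℝ) : 0 ≤ cutSq K x := mul_nonneg (sq_nonneg _) (le_max_left _ _)

theorem cutSq_le_sq {K : ℝ} (hK : 0 < K) (x : ℝ) : cutSq K x ≤ x ^ 2 := by
  refine mul_le_of_le_one_right (sq_nonneg _) (max_le zero_le_one ?_)
  have : 0 ≤ |x| / K := by positivity
  linarith

theorem cutSq_eq_zero {K : ℝ} (hK : 0 < K) {x : ℝ} (hx : K < |x|) : cutSq K x = 0 := by
  have : 1 ≤ |x| / K := by rw [le_div_iff₀ hK]; linarith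
  rw [cutSq, max_eq_left (by linarith), mul_zero]

theorem abs_cutSq_le {K : ℝ} (hK : 0 < K) (x : ℝ) : |cutSq K x| ≤ K ^ 2 := by
  rw [abs_of_nonneg (cutSq_nonneg _ _)]
  rcases lt_or_ge K |x| with h | h
  · rw [cutSq_eq_zero hK h]; positivity
  · refine (cutSq_le_sq hK x).trans ?_
    rw [← sq_abs x]; gcongr

theorem integrable_sq_gaussian : Integrable (fun x : ℝ => x ^ 2) (gaussianReal 0 1) :=
  (memLp_id_gaussianReal 2).integrable_sq

theorem integral_sq_gaussian : ∫ x : ℝ, x ^ 2 ∂(gaussianReal 0 1) = 1 := by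
  have h := variance_eq_sub (memLp_id_gaussianReal (μ := 0) (v := 1) 2)
  rw [variance_id_gaussianReal] at h
  simpa using h.symm

theorem tendsto_integral_cutSq {K : ℕ → ℝ} (hK : ∀ k, 0 < K k) (hKt : Tendsto K atTop atTop) :
    Tendsto (fun k => ∫ x, cutSq (K k) x ∂(gaussianReal 0 1)) atTop (𝓝 1) := by
  rw [← integral_sq_gaussian]
  refine tendsto_integral_of_dominated_convergence (fun x => x ^ 2)
    (fun k => (continuous_cutSq _).aestronglyMeasurable) integrable_sq_gaussian
    (fun k => Eventually.of_forall fun x => ?_) (Eventually.of_forall fun x => ?_)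
  · rw [Real.norm_eq_abs, abs_of_nonneg (cutSq_nonneg _ _)]; exact cutSq_le_sq (hK k) x
  · have h1 : Tendsto (fun k => |x| / K k) atTop (𝓝 0) := tendsto_const_nhds.div_atTop hKt
    have h2 := ((tendsto_const_nhds (x := (0 : ℝ))).max (h1.const_sub 1)).const_mul (x ^ 2)
    simpa [cutSq] using h2

/-- The cut-off square vanishes where |B| > K and never exceeds B², so it and the tail share a total
mass of 1. The tail is thus controlled by the mean of a bounded continuous function, which passes to
limits in distribution. -/
theorem setIntegral_sq_le_one_sub {B : Ω → ℝ} (hm : Measurable B) (hB : MemLp B 2 P)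
    (h1 : ∫ ω, B ω ^ 2 ∂P = 1) {K : ℝ} (hK : 0 < K) :
    ∫ ω in {ω | K < |B ω|}, B ω ^ 2 ∂P ≤ 1 - ∫ ω, cutSq K (B ω) ∂P := by
  have hms : MeasurableSet {ω | K < |B ω|} := measurableSet_lt measurable_const hm.abs
  have hi : Integrable (fun ω => B ω ^ 2) P := hB.integrable_sq
  have hc : Integrable (fun ω => cutSq K (B ω)) P :=
    Integrable.of_bound (C := K ^ 2) ((continuous_cutSq K).measurable.comp hm).aestronglyMeasurable
      (Eventually.of_forall fun _ => abs_cutSq_le hK _)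
  rw [← h1, ← integral_sub hi hc, ← integral_indicator hms]
  refine integral_mono (hi.indicator hms) (hi.sub hc) fun ω => ?_
  by_cases h : K < |B ω|
  · rw [indicator_of_mem (by exact h)]
    simp [cutSq_eq_zero hK h]
  · rw [indicator_of_notMem (by exact h)]
    exact sub_nonneg.2 (cutSq_le_sq hK _)

end GaussianLimits

end BlockCLT

/-! ### The two implications -/

namespace BlockCLT.ArrayAssumptions

variable {Ω : Type*} [MeasurableSpace Ω] {P : Measure Ω} [IsProbabilityMeasure P] {τ N : ℕ → ℕ}
  {X : ℕ → ℕ → Ω → ℝ} {σ : ℕ → ℕ → ℝ} {𝒥 : NestedPartitions}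

theorem tendstoInDistribution_blockSum (hX : ArrayAssumptions P τ N X σ 𝒥)
    (hratio : ∀ r : ℕ, Tendsto (fun n : ℕ => σ r n / σ (r + 1) n) atTop (𝓝 (√2)))
    {ε : ℕ → ℝ} (hε : Tendsto ε atTop (𝓝 0)) {M : ℕ → ℕ}
    (hM : ∀ k n : ℕ, M k < n → ∀ r ≤ k,
      ∫ ω in {ω | (2 : ℝ) ^ ((k : ℝ) / 4) < |blockSum τ N X σ r n ω|},
        (blockSum τ N X σ r n ω) ^ 2 ∂P ≤ ε k) (r : ℕ) :
    TendstoInDistribution (fun n : ℕ => blockSum τ N X σ r n) atTop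
      (id : ℝ → ℝ) (fun _ => P) (gaussianReal 0 1) := by
  rw [tendstoInDistribution_gaussian_iff fun n => (hX.measurable_blockSum r n).aemeasurable]
  intro t
  have := tendsto_exp_of_halving (f := fun r n t => ∫ ω, expChar t (blockSum τ N X σ r n ω) ∂P)
    (fun r n t => norm_integral_expChar_le _ _) (hX.tendsto_expChar_halving hratio) hε
    (fun k s => ?_) r t
  · simpa using this
  · filter_upwards [eventually_gt_atTop (M k), hX.eventually_one_lt_iterBlock k] with n hn hm
    -- The truncated moment bound enters on the diagonal r = k: deeper levels come with smaller ε.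
    exact norm_integral_expChar_sub_taylor_le (hX.measurable_blockSum k n) (hX.memLp_blockSum k n)
      (hX.integral_blockSum k n) (hX.integral_blockSum_sq hm) (by positivity) (hM k n hn k le_rfl) s

/-- The characteristic function of the rescaled S_r is asymptotic to φ_{r+1}(t)², which tends to
exp(-t²/2)² = exp(-t²), that of N(0,2). -/
theorem tendsto_ratio (hX : ArrayAssumptions P τ N X σ 𝒥)
    (h : ∀ r : ℕ, TendstoInDistribution (fun n : ℕ => blockSum τ N X σ r n) atTop
      (id : ℝ → ℝ) (fun _ => P) (gaussianReal 0 1)) (r : ℕ) :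
    Tendsto (fun n : ℕ => σ r n / σ (r + 1) n) atTop (𝓝 (√2)) := by
  refine tendsto_scale_of_gaussian_limits ?_ (h r) ?_
  · filter_upwards [hX.eventually_one_lt_iterBlock (r + 1)] with n hm
    exact div_pos (hX.sigma_pos r n (hX.one_lt_iterBlock_of_succ hm)) (hX.sigma_pos (r + 1) n hm)
  · rw [tendstoInDistribution_gaussian_iff fun n =>
      ((hX.measurable_blockSum r n).const_mul _).aemeasurable]
    intro t
    have h1 := (tendstoInDistribution_gaussian_iff
      (fun n => (hX.measurable_blockSum (r + 1) n).aemeasurable) 1).1 (h (r + 1)) t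
    have h2 := (hX.tendsto_expChar_ratio_mul r t).add (h1.pow 2)
    rw [zero_add, ← Complex.exp_nat_mul] at h2
    convert! h2 using 2
    · ring
    · push_cast; ring_nf

theorem exists_truncated_second_moment_bound (hX : ArrayAssumptions P τ N X σ 𝒥)
    (h : ∀ r : ℕ, TendstoInDistribution (fun n : ℕ => blockSum τ N X σ r n) atTop
      (id : ℝ → ℝ) (fun _ => P) (gaussianReal 0 1)) :
    ∃ ε : ℕ → ℝ, Tendsto ε atTop (𝓝 0) ∧ ∃ M : ℕ → ℕ, StrictMono M ∧
      ∀ k n : ℕ, M k < n → ∀ r ≤ k,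
        ∫ ω in {ω | (2 : ℝ) ^ ((k : ℝ) / 4) < |blockSum τ N X σ r n ω|},
          (blockSum τ N X σ r n ω) ^ 2 ∂P ≤ ε k := by
  set K : ℕ → ℝ := fun k => (2 : ℝ) ^ ((k : ℝ) / 4) with hKdef
  have hK : ∀ k, 0 < K k := fun k => by positivity
  have hKt : Tendsto K atTop atTop := by
    simp only [hKdef, Real.rpow_def_of_pos (zero_lt_two' ℝ)]
    exact Real.tendsto_exp_atTop.comp (Tendsto.const_mul_atTop (Real.log_pos one_lt_two)
      (tendsto_natCast_atTop_atTop.atTop_div_const (by norm_num)))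
  -- The Gaussian value of the bound, plus a slack 1/(k + 1) that turns convergence in n into an
  -- eventual inequality for the finitely many r ≤ k.
  set ε : ℕ → ℝ := fun k => 1 - ∫ x, cutSq (K k) x ∂(gaussianReal 0 1) + 1 / ((k : ℝ) + 1) with hε
  have hεt : Tendsto ε atTop (𝓝 0) := by
    have := ((tendsto_integral_cutSq hK hKt).const_sub 1).add
      (tendsto_one_div_add_atTop_nhds_zero_nat (𝕜 := ℝ))
    rwa [sub_self, add_zero] at this
  have hev : ∀ k : ℕ, ∀ᶠ m in atTop, ∀ n : ℕ, m < n → ∀ r ≤ k,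
      ∫ ω in {ω | K k < |blockSum τ N X σ r n ω|}, (blockSum τ N X σ r n ω) ^ 2 ∂P ≤ ε k := by
    intro k
    have h1 : ∀ᶠ n in atTop, ∀ r ∈ Finset.range (k + 1),
        ∫ ω in {ω | K k < |blockSum τ N X σ r n ω|}, (blockSum τ N X σ r n ω) ^ 2 ∂P ≤ ε k := by
      rw [Finset.eventually_all]
      intro r _
      have hlim := tendsto_integral_of_tendstoInDistribution_id (h r) (continuous_cutSq (K k))
        (abs_cutSq_le (hK k))
      have hpos : (0 : ℝ) < 1 / ((k : ℝ) + 1) := by positivity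
      filter_upwards [hX.eventually_one_lt_iterBlock r,
        hlim.eventually (lt_mem_nhds (sub_lt_self _ hpos))] with n hm hn
      refine (setIntegral_sq_le_one_sub (hX.measurable_blockSum r n) (hX.memLp_blockSum r n)
        (hX.integral_blockSum_sq hm) (hK k)).trans ?_
      simp only [hε]
      linarith
    obtain ⟨n₀, hn₀⟩ := eventually_atTop.1 h1
    filter_upwards [eventually_ge_atTop n₀] with m hm n hn r hr
    exact hn₀ n (hm.trans hn.le) r (Finset.mem_range.2 (by omega))
  obtain ⟨M, hM, hMk⟩ := extraction_forall_of_eventually hev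
  exact ⟨ε, hεt, M, hM, hMk⟩

end BlockCLT.ArrayAssumptions

theorem mainTheorem4 {Ω : Type*} [MeasurableSpace Ω] (P : Measure Ω) [IsProbabilityMeasure P]
    (τ N : ℕ → ℕ) (X : ℕ → ℕ → Ω → ℝ) (σ : ℕ → ℕ → ℝ) (𝒥 : NestedPartitions)
    (hX : ArrayAssumptions P τ N X σ 𝒥) :
    (∀ r : ℕ, TendstoInDistribution (fun n : ℕ => blockSum τ N X σ r n) atTop
        (id : ℝ → ℝ) (fun _ => P) (gaussianReal 0 1)) ↔
      (∀ r : ℕ, Tendsto (fun n : ℕ => σ r n / σ (r + 1) n) atTop (𝓝 (√2))) ∧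
      ∃ ε : ℕ → ℝ, Tendsto ε atTop (𝓝 0) ∧ ∃ M : ℕ → ℕ, StrictMono M ∧
        ∀ k n : ℕ, M k < n → ∀ r ≤ k,
          ∫ ω in {ω | (2 : ℝ) ^ ((k : ℝ) / 4) < |blockSum τ N X σ r n ω|},
            (blockSum τ N X σ r n ω) ^ 2 ∂P ≤ ε k := by
  constructor
  · intro h
    exact ⟨hX.tendsto_ratio h, hX.exists_truncated_second_moment_bound h⟩
  · rintro ⟨hratio, ε, hε, M, -, hM⟩ r
    exact hX.tendstoInDistribution_blockSum hratio hε hM r
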